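/- Fix an integer $m\ge 1$, a finite set $\mathcal Y$, and constants $\kappa>0$ and $0<c<4$ (for instance $c=3.99$). **Model.** There are $n$ unknown states $x_1,\dots,x_n\in\mathbb Z/m$, an observation rate $p_{\mathrm{obs}}=p_{\mathrm{obs},n}\in[0,1]$, and output distributions $P_{l,n}$, $l\in\mathbb Z/m$, on $\mathcal Y$. Independently over the pairs $i>j$, the pair $(i,j)$ is sampled with probability $p_{\mathrm{obs}}$, independently of the samples, and a sampled pair reveals $y_{i,j}\sim P_{x_i-x_j,\,n}$. For an estimate $\hat x\in(\mathbb Z/m)^n$ let $$\mathsf{MCR}(\hat x,x)=\frac1n\min_{l\in\mathbb Z/m}\#\{i:\hat x_i\ne x_i+l\}.$$ For each $n$ the family $(P_{l,n})_l$ is compatible with the cyclic structure in at least one of these two senses: (a) $P_{l,n}$ is the $l$-fold shift of $P_{0,n}$, that is, for some permutation $\sigma$ of $\mathcal Y$, $P_{l+1,n}$ is the image of $P_{l,n}$ under $\sigma$ for all $l$; (b) reversing a pair only relabels its sample, that is, for some permutation $\rho$ of $\mathcal Y$, $P_{-l,n}$ is the image of $P_{l,n}$ under $\rho$ for all $l$.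 (The additive model $y_{i,j}=x_i-x_j+\eta_{i,j}\bmod m$ with i.i.d. noise $\eta_{i,j}$ satisfies (a) with $\sigma(y)=y+1$, and also (b) with $\rho(y)=-y$ when the noise is symmetric.) **Theorem.** There is a constant $c_0>0$, depending only on $m,\mathcal Y,\kappa,c$, such that the following holds for all such sequences with $P_{l,n}(y)\ge\kappa$ for all $l,n,y$. Suppose that there is a fixed $l\neq 0$ with $$\mathsf{KL}(P_{0,n}\,\|\,P_{l,n})=\mathsf{KL}_{\min,n}:=\min_{j\ne 0}\mathsf{KL}(P_{0,n}\,\|\,P_{j,n})$$ for all sufficiently large $n$, where $\mathsf{KL}(P\|Q)=\sum_y P(y)\log\frac{P(y)}{Q(y)}$, and that, for all sufficiently large $n$, $$p_{\mathrm{obs}}>\frac{c_0\log n}{n}\qquad\text{and}\qquad \mathsf{KL}_{\min,n}<\frac{c\log n}{n\,p_{\mathrm{obs}}}.$$ Then the minimax probability of error tends to one: $$\inf_{\hat x}\ \max_{x\in(\mathbb Z/m)^n}\ \mathbb P\bigl(\mathsf{MCR}(\hat x,x)>0\mid x\bigr)\longrightarrow 1\qquad(n\to\infty),$$ where the infimum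 is over all (possibly randomized) estimators $\hat x$ based on the data. -/

import Mathlib

open Filter Topology
open scoped ENNReal

noncomputable section

namespace JointAlignment

/-- The unordered pairs of distinct indices, written as `(i, j)` with `i > j`. -/
abbrev Pairs (n : ℕ) : Type := {e : Fin n × Fin n // e.2 < e.1}

/-- A data set: for every pair `i > j` either `none` (the pair is not in the random index set)
or `some y`, the observed sample of that pair. -/
abbrev Obs (n : ℕ) (Y : Type*) : Type _ := Pairs n → Option Y

/-- The law of the data on one pair: it is sampled with probability `p`, and then, independently,
the sample has law `q`. -/
def edgeLaw {Y : Type*} [Fintype Y] (p : unitInterval) (q : PMF Y) : PMF (Option Y) :=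
  PMF.ofFintype
    (fun o => match o with
      | none => (unitInterval.toNNReal (unitInterval.symm p) : ℝ≥0∞)
      | some y => (unitInterval.toNNReal p : ℝ≥0∞) * q y)
    (by
      have h : ∑ y, q y = 1 := (tsum_fintype (fun y => q y)).symm.trans q.tsum_coe
      rw [Fintype.sum_option, ← Finset.mul_sum, h, mul_one, ← ENNReal.coe_add,
        unitInterval.toNNReal_symm_add_toNNReal, ENNReal.coe_one])

/-- The product of finitely many laws on a finite set (independent coordinates). -/
def piLaw {ι α : Type*} [Fintype ι] [DecidableEq ι] [Fintype α] (q : ι → PMF α) : PMF (ι → α) :=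
  PMF.ofFintype (fun ω => ∏ i, q i (ω i))
    (by
      have h : ∀ i, ∑ a, q i a = 1 := fun i =>
        (tsum_fintype (fun a => q i a)).symm.trans (q i).tsum_coe
      rw [← Fintype.piFinset_univ, ← Finset.prod_univ_sum]
      simp [h])

/-- The law of the data given the states `x`: independently over the pairs `i > j`, the pair is
sampled with probability `p`, and its sample then has law `P (x i - x j)`. -/
def obsLaw {m n : ℕ} {Y : Type*} [Fintype Y] (p : unitInterval) (P : ZMod m → PMF Y)
    (x : Fin n → ZMod m) : PMF (Obs n Y) :=
  piLaw fun e : Pairs n => edgeLaw p (P (x e.1.1 - x e.1.2))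

/-- The misclassification rate: the fraction of indices at which the estimate differs from the
truth, minimized over the global cyclic shifts of the truth. -/
def mcr {m n : ℕ} (xhat x : Fin n → ZMod m) : ℝ :=
  (1 / n) * ⨅ l : ZMod m, (hammingDist xhat (fun i => x i + l) : ℝ)

/-- A (possibly randomized) estimator: it maps the data to the law of the estimate. A deterministic
estimator is one whose values are point masses. -/
abbrev Estimator (m n : ℕ) (Y : Type*) : Type _ := Obs n Y → PMF (Fin n → ZMod m)

/-- The probability, given the states `x`, that the estimator `g` has `MCR > 0`. -/
def errorProb {m n : ℕ} {Y : Type*} [Fintype Y] (p : unitInterval) (P : ZMod m → PMF Y)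
    (g : Estimator m n Y) (x : Fin n → ZMod m) : ℝ≥0∞ :=
  ((obsLaw p P x).bind g).toOuterMeasure {xhat | 0 < mcr xhat x}

/-- The minimax probability of error with `n` variables. -/
def minimaxError {m : ℕ} {Y : Type*} [Fintype Y] (n : ℕ) (p : unitInterval)
    (P : ZMod m → PMF Y) : ℝ≥0∞ :=
  ⨅ g : Estimator m n Y, ⨆ x : Fin n → ZMod m, errorProb p P g x

/-- The Kullback–Leibler divergence on a finite set (used for everywhere positive laws). -/
def kl {Y : Type*} [Fintype Y] (p q : PMF Y) : ℝ :=
  ∑ y, (p y).toReal * Real.log ((p y).toReal / (q y).toReal)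

/-- The minimum of `KL (P 0 ‖ P j)` over `j ≠ 0`. -/
def klMin {m : ℕ} {Y : Type*} [Fintype Y] (P : ZMod m → PMF Y) : ℝ :=
  ⨅ j : {j : ZMod m // j ≠ 0}, kl (P 0) (P j)

/-- The `P l` are the cyclic shifts of `P 0`, for some relabelling `σ` of the outputs that plays
the role of `y ↦ y + 1`. For `y = x i - x j + η` modulo `m`, where `P l (y) = P 0 (y - l)`,
this holds with `σ y = y + 1`, whatever the law of the noise `η`. -/
def IsShiftFamily {m : ℕ} {Y : Type*} (P : ZMod m → PMF Y) : Prop :=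
  ∃ σ : Equiv.Perm Y, ∀ l, P (l + 1) = (P l).map σ

/-- Reversing a pair only relabels its sample: for some relabelling `ρ` of the outputs, `ρ y` has
law `P (-l)` when `y` has law `P l`, so that with `y j i := ρ (y i j)` the sample of every ordered
pair has law `P (x i - x j)`. For `y = x i - x j + η` modulo `m` with symmetric
noise `η` this holds with `ρ y = -y`. -/
def IsReversible {m : ℕ} {Y : Type*} (P : ZMod m → PMF Y) : Prop :=
  ∃ ρ : Equiv.Perm Y, ∀ l, P (-l) = (P l).map ρ

end JointAlignment

end

/-! Write `c = 4(1 - s)` and `L = log n`. Recovery fails because changing a single state often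
explains the data almost as well as the truth. Put a uniform prior on the states with values in `{0,
l}` on an initial block of about `s n / 576` indices and `0` elsewhere. If the flips (exchanging `0`
and `l` at one block index) of the true `x` carry `T` times its likelihood, its posterior mass is at
most `1/T`. An estimate is correct for only `m` states, so the success probability is at most `m/T`
plus that of the bad event (`exists_errorProb_ge`).

The log-likelihood ratio of a flip at `i` is a sum over the edges at `i`. Edges inside the block are
few, and by an exponential moment their sum is rarely below `-b`, with `b = (s/8) L`. Edges leaving
the block form disjoint sets for distinct `i`, so the corresponding events are pairwise independent.
Their sum lies in `[-b, b]` with probability at least about `exp(-b/2)` times the product of the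
Bhattacharyya coefficients of the edges (`piExp_abs_sum_le_ge`): under the normalized geometric mean
of the two laws the ratio is nearly centred.

For laws bounded below with small divergence, one minus this coefficient is at most about a quarter
of the divergence (`isClosePair_of_kl_le`); this is the source of the threshold `4`. The product
over at most `n` edges, each sampled with probability `p`, is then at least `n ^ (-(1 - s/2))`.
After the losses in `b` a positive power of `n` remains, and a second moment argument
(`piExp_count_lt_le`) shows that the flips outweigh the truth by such a power.

A flip moves differences between `0` and `±l`. The cyclic structure transfers closeness of the laws
at `0` and `l` to those at `0` and `-l` (`IsClosePair.closePairs`). -/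

namespace JointAlignment

/-! ### Finite product measures: independence, tilting, second moments. -/

section ProductWeights

variable {ι α : Type*} [Fintype ι] [DecidableEq ι] [Fintype α]

/-- The expectation of `f` under the product of the weights `q e` on a finite set. -/
def piExp (q : ι → α → ℝ) (f : (ι → α) → ℝ) : ℝ :=
  ∑ ω : ι → α, (∏ e, q e (ω e)) * f ω

lemma piExp_prod (q : ι → α → ℝ) (f : ι → α → ℝ) :
    piExp q (fun ω => ∏ e, f e (ω e)) = ∏ e, ∑ a, q e a * f e a := by
  rw [Finset.prod_univ_sum, Fintype.piFinset_univ]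
  simp [piExp, Finset.prod_mul_distrib]

lemma piExp_one {q : ι → α → ℝ} (hq : ∀ e, ∑ a, q e a = 1) : piExp q (fun _ => 1) = 1 := by
  have := piExp_prod q (fun _ _ => 1)
  simpa [hq] using this

lemma piExp_mono {q : ι → α → ℝ} (h0 : ∀ e a, 0 ≤ q e a) {f g : (ι → α) → ℝ}
    (hfg : ∀ ω, f ω ≤ g ω) : piExp q f ≤ piExp q g :=
  Finset.sum_le_sum fun ω _ =>
    mul_le_mul_of_nonneg_left (hfg ω) (Finset.prod_nonneg fun e _ => h0 e _)

lemma piExp_add (q : ι → α → ℝ) (f g : (ι → α) → ℝ) :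
    piExp q (fun ω => f ω + g ω) = piExp q f + piExp q g := by
  simp [piExp, mul_add, Finset.sum_add_distrib]

lemma piExp_const_mul (q : ι → α → ℝ) (c : ℝ) (f : (ι → α) → ℝ) :
    piExp q (fun ω => c * f ω) = c * piExp q f := by
  simp only [piExp, Finset.mul_sum]
  exact Finset.sum_congr rfl fun _ _ => by ring

lemma piExp_const {q : ι → α → ℝ} (hq : ∀ e, ∑ a, q e a = 1) (c : ℝ) :
    piExp q (fun _ => c) = c := by
  have := piExp_const_mul q c (fun _ => 1)
  simpa [piExp_one hq] using this

lemma piExp_sum {κ : Type*} (q : ι → α → ℝ) (s : Finset κ) (f : κ → (ι → α) → ℝ) :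
    piExp q (fun ω => ∑ i ∈ s, f i ω) = ∑ i ∈ s, piExp q (f i) := by
  simp only [piExp, Finset.mul_sum]
  exact Finset.sum_comm

lemma piExp_nonneg {q : ι → α → ℝ} (h0 : ∀ e a, 0 ≤ q e a) {f : (ι → α) → ℝ}
    (hf : ∀ ω, 0 ≤ f ω) : 0 ≤ piExp q f :=
  Finset.sum_nonneg fun ω _ => mul_nonneg (Finset.prod_nonneg fun e _ => h0 e _) (hf ω)

/-- Exchanging the coordinates in `S` of two configurations. -/
def swapCoords (S : Finset ι) : (ι → α) × (ι → α) ≃ (ι → α) × (ι → α) where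
  toFun p := (S.piecewise p.1 p.2, S.piecewise p.2 p.1)
  invFun p := (S.piecewise p.1 p.2, S.piecewise p.2 p.1)
  left_inv p := by
    ext e <;> by_cases h : e ∈ S <;> simp [h]
  right_inv p := by
    ext e <;> by_cases h : e ∈ S <;> simp [h]

/-- Functions of disjoint sets of coordinates are independent. -/
lemma piExp_mul_of_dependsOn {q : ι → α → ℝ} (hq : ∀ e, ∑ a, q e a = 1) (S : Finset ι)
    {f g : (ι → α) → ℝ} (hf : DependsOn f (S : Set ι)) (hg : DependsOn g (S : Set ι)ᶜ) :
    piExp q (fun ω => f ω * g ω) = piExp q f * piExp q g := by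
  have h1 : piExp q (fun ω => f ω * g ω)
      = ∑ p : (ι → α) × (ι → α),
        ((∏ e, q e (p.1 e)) * (f p.1 * g p.1)) * ((∏ e, q e (p.2 e)) * 1) := by
    rw [Fintype.sum_prod_type]
    dsimp only
    rw [← Finset.sum_mul_sum]
    have := piExp_one hq
    unfold piExp at this ⊢
    rw [this, mul_one]
  have h2 : piExp q f * piExp q g
      = ∑ p : (ι → α) × (ι → α),
        ((∏ e, q e (p.1 e)) * f p.1) * ((∏ e, q e (p.2 e)) * g p.2) := by
    rw [Fintype.sum_prod_type]
    dsimp only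
    rw [← Finset.sum_mul_sum]
    rfl
  -- With an independent copy added, swapping the coordinates in `S` preserves the product weight
  -- and turns `f ω * g ω` into `f ω * g ω'`.
  rw [h1, h2, ← (swapCoords S).sum_comp]
  refine Finset.sum_congr rfl fun p _ => ?_
  have e1 : f (S.piecewise p.1 p.2) = f p.1 := hf fun e he => by
    simp [Finset.mem_coe.1 he]
  have e2 : g (S.piecewise p.1 p.2) = g p.2 := hg fun e he => by
    have : e ∉ S := by simpa using he
    simp [this]
  have e3 : (∏ e, q e (S.piecewise p.1 p.2 e)) * (∏ e, q e (S.piecewise p.2 p.1 e))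
      = (∏ e, q e (p.1 e)) * (∏ e, q e (p.2 e)) := by
    rw [← Finset.prod_mul_distrib, ← Finset.prod_mul_distrib]
    refine Finset.prod_congr rfl fun e _ => ?_
    by_cases h : e ∈ S <;> simp [h, mul_comm]
  simp only [swapCoords, Equiv.coe_fn_mk, e1, e2]
  calc _ = ((∏ e, q e (S.piecewise p.1 p.2 e)) * (∏ e, q e (S.piecewise p.2 p.1 e)))
        * (f p.1 * g p.2) := by ring
    _ = _ := by rw [e3]; ring

lemma piExp_apply {q : ι → α → ℝ} (hq : ∀ e, ∑ a, q e a = 1) (e : ι) (f : α → ℝ) :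
    piExp q (fun ω => f (ω e)) = ∑ a, q e a * f a := by
  have h := piExp_prod q (fun j a => if j = e then f a else 1)
  simp only [Finset.prod_ite_eq', Finset.mem_univ, if_true] at h
  rw [h, Finset.prod_eq_single e]
  · simp
  · intro j _ hj
    simp [hj, hq]
  · simp

/-- The second moment of a sum of independent variables. -/
lemma piExp_sum_sq_le {q : ι → α → ℝ} (hq : ∀ e, ∑ a, q e a = 1) (Z : ι → α → ℝ) :
    piExp q (fun ω => (∑ e, Z e (ω e)) ^ 2)
      ≤ (∑ e, ∑ a, q e a * Z e a ^ 2) + (∑ e, ∑ a, q e a * Z e a) ^ 2 := by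
  have h1 : piExp q (fun ω => (∑ e, Z e (ω e)) ^ 2)
      = ∑ e, ∑ e', piExp q (fun ω => Z e (ω e) * Z e' (ω e')) := by
    simp_rw [sq, Finset.sum_mul_sum, piExp_sum]
  rw [h1, sq, Finset.sum_mul_sum, ← Finset.sum_add_distrib]
  refine Finset.sum_le_sum fun e _ => ?_
  have h2 : ∀ e', piExp q (fun ω => Z e (ω e) * Z e' (ω e'))
      ≤ (if e = e' then ∑ a, q e a * Z e a ^ 2 else 0)
        + (∑ a, q e a * Z e a) * ∑ a, q e' a * Z e' a := by
    intro e'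
    by_cases h : e = e'
    · subst h
      simp only [if_true]
      have := piExp_apply hq e (fun a => Z e a * Z e a)
      rw [this]
      simp only [sq]
      nlinarith [mul_self_nonneg (∑ a, q e a * Z e a)]
    · rw [if_neg h, zero_add]
      rw [piExp_mul_of_dependsOn (f := fun ω => Z e (ω e)) (g := fun ω => Z e' (ω e')) hq {e}
        (fun a b hab => congrArg (Z e) (hab e (by simp)))
        (fun a b hab => congrArg (Z e') (hab e' (by simpa using Ne.symm h)))]
      rw [piExp_apply hq e (Z e), piExp_apply hq e' (Z e')]
  calc _ ≤ _ := Finset.sum_le_sum fun e' _ => h2 e'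
    _ = _ := by rw [Finset.sum_add_distrib]; simp

open Classical in
/-- A lower bound for the probability that a sum of log-likelihood ratios is close to zero, by
the change of measure to the normalized geometric mean of the two laws. -/
lemma piExp_abs_sum_le_ge {q Z : ι → α → ℝ} (h0 : ∀ e a, 0 ≤ q e a) {t : ι → ℝ} {η τ b : ℝ}
    (hη0 : 0 ≤ η) (hη : η ≤ 1 / 2) (ht0 : ∀ e, 0 ≤ t e) (ht : ∀ e, t e ≤ η)
    (h1 : ∀ e, 1 - t e ≤ ∑ a, q e a * Real.exp (Z e a / 2))
    (h2 : ∀ e, |∑ a, q e a * Real.exp (Z e a / 2) * Z e a| ≤ 8 * η * t e)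
    (h3 : ∀ e, ∑ a, q e a * Real.exp (Z e a / 2) * Z e a ^ 2 ≤ 8 * t e)
    (hτ : ∑ e, t e ≤ τ) (hb : 0 < b) (hbτ : 16 * τ + (16 * η * τ) ^ 2 ≤ b ^ 2 / 2) :
    Real.exp (-(τ / (1 - η)) - b / 2) / 2
      ≤ piExp q (fun ω => if |∑ e, Z e (ω e)| ≤ b then 1 else 0) := by
  set ρ : ι → ℝ := fun e => ∑ a, q e a * Real.exp (Z e a / 2) with hρ
  have hρ2 : ∀ e, 1 / 2 ≤ ρ e := fun e => by
    have := h1 e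
    have := ht e
    simp only [hρ]
    linarith
  have hρ0 : ∀ e, 0 < ρ e := fun e => by linarith [hρ2 e]
  set r : ι → α → ℝ := fun e a => q e a * Real.exp (Z e a / 2) / ρ e with hr
  have hr1 : ∀ e, ∑ a, r e a = 1 := fun e => by
    simp only [hr]
    rw [← Finset.sum_div]
    exact div_self (hρ0 e).ne'
  have hr0 : ∀ e a, 0 ≤ r e a := fun e a =>
    div_nonneg (mul_nonneg (h0 e a) (Real.exp_pos _).le) (hρ0 e).le
  have hm : ∀ e, |∑ a, r e a * Z e a| ≤ 16 * η * t e := fun e => by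
    have : ∑ a, r e a * Z e a = (∑ a, q e a * Real.exp (Z e a / 2) * Z e a) / ρ e := by
      rw [Finset.sum_div]
      exact Finset.sum_congr rfl fun a _ => by simp only [hr]; ring
    rw [this, abs_div, abs_of_pos (hρ0 e), div_le_iff₀ (hρ0 e)]
    nlinarith [h2 e, hρ2 e, mul_nonneg hη0 (ht0 e)]
  have hv : ∀ e, ∑ a, r e a * Z e a ^ 2 ≤ 16 * t e := fun e => by
    have : ∑ a, r e a * Z e a ^ 2 = (∑ a, q e a * Real.exp (Z e a / 2) * Z e a ^ 2) / ρ e := by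
      rw [Finset.sum_div]
      exact Finset.sum_congr rfl fun a _ => by simp only [hr]; ring
    rw [this, div_le_iff₀ (hρ0 e)]
    nlinarith [h3 e, hρ2 e, ht0 e]
  have hW : piExp r (fun ω => (∑ e, Z e (ω e)) ^ 2) ≤ b ^ 2 / 2 := by
    refine (piExp_sum_sq_le hr1 Z).trans (le_trans ?_ hbτ)
    have a1 : ∑ e, ∑ a, r e a * Z e a ^ 2 ≤ 16 * τ := by
      calc _ ≤ ∑ e, 16 * t e := Finset.sum_le_sum fun e _ => hv e
        _ ≤ 16 * τ := by rw [← Finset.mul_sum]; linarith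
    have a2 : |∑ e, ∑ a, r e a * Z e a| ≤ 16 * η * τ := by
      calc _ ≤ ∑ e, |∑ a, r e a * Z e a| := Finset.abs_sum_le_sum_abs _ _
        _ ≤ ∑ e, 16 * η * t e := Finset.sum_le_sum fun e _ => hm e
        _ ≤ 16 * η * τ := by
          rw [← Finset.mul_sum]
          exact mul_le_mul_of_nonneg_left hτ (by positivity)
    have a3 := sq_le_sq' (neg_le_of_abs_le a2) (le_of_abs_le a2)
    linarith
  -- Chebyshev under the tilted law.
  have hprob : (1 : ℝ) / 2 ≤ piExp r (fun ω => if |∑ e, Z e (ω e)| ≤ b then 1 else 0) := by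
    have : ∀ ω : ι → α, 1 + (-(1 / b ^ 2)) * (∑ e, Z e (ω e)) ^ 2
        ≤ if |∑ e, Z e (ω e)| ≤ b then 1 else 0 := by
      intro ω
      split_ifs with h
      · have : 0 ≤ 1 / b ^ 2 * (∑ e, Z e (ω e)) ^ 2 := by positivity
        linarith
      · have h' : b ^ 2 ≤ (∑ e, Z e (ω e)) ^ 2 := by
          rw [← sq_abs (∑ e, Z e (ω e))]
          exact pow_le_pow_left₀ hb.le (not_le.1 h).le 2
        have : 1 ≤ 1 / b ^ 2 * (∑ e, Z e (ω e)) ^ 2 := by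
          rw [one_div, ← div_eq_inv_mul, one_le_div (by positivity)]
          exact h'
        linarith
    have h := piExp_mono hr0 this
    rw [piExp_add, piExp_const_mul, piExp_one hr1] at h
    have h5 : 1 / b ^ 2 * piExp r (fun ω => (∑ e, Z e (ω e)) ^ 2) ≤ 1 / b ^ 2 * (b ^ 2 / 2) :=
      mul_le_mul_of_nonneg_left hW (by positivity)
    have h6 : 1 / b ^ 2 * (b ^ 2 / 2) = 1 / 2 := by field_simp
    linarith
  have hprod : Real.exp (-(τ / (1 - η))) ≤ ∏ e, ρ e := by
    have hη1 : 0 < 1 - η := by linarith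
    have hstep : ∀ e, Real.exp (-(t e / (1 - η))) ≤ ρ e := by
      intro e
      have hte : 0 < 1 - t e := by linarith [ht e]
      refine le_trans ?_ (h1 e)
      have h7 : t e / (1 - t e) ≤ t e / (1 - η) :=
        div_le_div_of_nonneg_left (ht0 e) hη1 (by linarith [ht e])
      have h8 : 1 / (1 - t e) ≤ Real.exp (t e / (1 - η)) := by
        have := Real.add_one_le_exp (t e / (1 - η))
        have h9 : 1 / (1 - t e) = t e / (1 - t e) + 1 := by field_simp; ring
        linarith
      rw [Real.exp_neg]
      rw [inv_le_comm₀ (Real.exp_pos _) hte]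
      simpa using h8
    calc Real.exp (-(τ / (1 - η))) ≤ Real.exp (∑ e, -(t e / (1 - η))) := by
          apply Real.exp_le_exp.2
          rw [Finset.sum_neg_distrib, ← Finset.sum_div]
          exact neg_le_neg (div_le_div_of_nonneg_right hτ hη1.le)
      _ = ∏ e, Real.exp (-(t e / (1 - η))) := Real.exp_sum _ _
      _ ≤ ∏ e, ρ e := Finset.prod_le_prod (fun e _ => (Real.exp_pos _).le) fun e _ => hstep e
  -- The density of `q` with respect to `r` is `(∏ ρ) * exp (-(∑ Z) / 2)`, and `∑ Z ≤ b` on the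
  -- event.
  have hchange : (∏ e, ρ e) * Real.exp (-(b / 2))
      * piExp r (fun ω => if |∑ e, Z e (ω e)| ≤ b then 1 else 0)
      ≤ piExp q (fun ω => if |∑ e, Z e (ω e)| ≤ b then 1 else 0) := by
    rw [piExp, Finset.mul_sum]
    refine Finset.sum_le_sum fun ω _ => ?_
    by_cases h : |∑ e, Z e (ω e)| ≤ b
    · have e1 : ∏ e, r e (ω e)
          = (∏ e, q e (ω e)) * Real.exp ((∑ e, Z e (ω e)) / 2) / ∏ e, ρ e := by
        rw [Finset.sum_div, Real.exp_sum, ← Finset.prod_mul_distrib, ← Finset.prod_div_distrib]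
      have hP : 0 < ∏ e, ρ e := Finset.prod_pos fun e _ => hρ0 e
      have hQ : 0 ≤ ∏ e, q e (ω e) := Finset.prod_nonneg fun e _ => h0 e _
      simp only [h, if_true]
      rw [e1, mul_one, mul_one]
      calc _ = (∏ e, q e (ω e)) * Real.exp (-(b / 2) + (∑ e, Z e (ω e)) / 2) := by
            rw [Real.exp_add]; field_simp
        _ ≤ (∏ e, q e (ω e)) * 1 := by
            refine mul_le_mul_of_nonneg_left (Real.exp_le_one_iff.2 ?_) hQ
            linarith [(abs_le.1 h).2]
        _ = _ := mul_one _
    · simp [h]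
  refine le_trans ?_ hchange
  rw [show -(τ / (1 - η)) - b / 2 = -(τ / (1 - η)) + -(b / 2) by ring, Real.exp_add]
  have := mul_le_mul_of_nonneg_right hprod (Real.exp_pos (-(b / 2))).le
  have h10 : 0 ≤ (∏ e, ρ e) * Real.exp (-(b / 2)) := le_trans (by positivity) this
  nlinarith [mul_le_mul_of_nonneg_left hprob h10]

open Classical in
/-- Markov's inequality for the lower tail of a sum of log-likelihood ratios. -/
lemma piExp_sum_lt_neg_le {q Z : ι → α → ℝ} (h0 : ∀ e a, 0 ≤ q e a) {t : ι → ℝ} {τ b : ℝ}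
    (h4 : ∀ e, ∑ a, q e a * Real.exp (-Z e a) ≤ 1 + t e) (hτ : ∑ e, t e ≤ τ) :
    piExp q (fun ω => if -b ≤ ∑ e, Z e (ω e) then 0 else 1) ≤ Real.exp (τ - b) := by
  have h1 : ∀ ω : ι → α, (if -b ≤ ∑ e, Z e (ω e) then (0 : ℝ) else 1)
      ≤ Real.exp (-b) * ∏ e, Real.exp (-Z e (ω e)) := by
    intro ω
    rw [← Real.exp_sum, ← Real.exp_add, Finset.sum_neg_distrib]
    split_ifs with h
    · positivity
    · exact Real.one_le_exp (by linarith)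
  refine (piExp_mono h0 h1).trans ?_
  rw [piExp_const_mul, piExp_prod q (fun e a => Real.exp (-Z e a)), sub_eq_neg_add, Real.exp_add]
  refine mul_le_mul_of_nonneg_left ?_ (Real.exp_pos _).le
  calc _ ≤ ∏ e, Real.exp (t e) := Finset.prod_le_prod
        (fun e _ => Finset.sum_nonneg fun a _ => mul_nonneg (h0 e a) (Real.exp_pos _).le)
        fun e _ => (h4 e).trans (by linarith [Real.add_one_le_exp (t e)])
    _ = Real.exp (∑ e, t e) := (Real.exp_sum _ _).symm
    _ ≤ _ := Real.exp_le_exp.2 hτ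

open Classical in
/-- If the events with indicators `f i` are pairwise independent with expected number `μ`, and each
of them is independent of an exceptional event with indicator `g i` and probability at most `ε`,
then with high probability at least `μ / 4` of them occur without the exceptional event. -/
lemma piExp_count_lt_le {κ : Type*} {q : ι → α → ℝ} (h0 : ∀ e a, 0 ≤ q e a)
    (hq : ∀ e, ∑ a, q e a = 1) (A : Finset κ) (f g : κ → (ι → α) → ℝ)
    (hf : ∀ i ω, f i ω = 0 ∨ f i ω = 1) (hg : ∀ i ω, 0 ≤ g i ω)
    (hff : ∀ i ∈ A, ∀ j ∈ A, i ≠ j →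
      piExp q (fun ω => f i ω * f j ω) = piExp q (f i) * piExp q (f j))
    (hfg : ∀ i ∈ A, piExp q (fun ω => f i ω * g i ω) = piExp q (f i) * piExp q (g i))
    {ε μ : ℝ} (hε : ∀ i ∈ A, piExp q (g i) ≤ ε) (hμ : μ = ∑ i ∈ A, piExp q (f i)) (hμ0 : 0 < μ) :
    piExp q (fun ω => if μ / 4 ≤ ∑ i ∈ A, f i ω * (1 - g i ω) then 0 else 1)
      ≤ 4 / μ + 4 * ε := by
  have hf0 : ∀ i ω, 0 ≤ f i ω := fun i ω => by rcases hf i ω with h | h <;> simp [h]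
  have hff1 : ∀ i ω, f i ω * f i ω = f i ω := fun i ω => by
    rcases hf i ω with h | h <;> simp [h]
  have hE0 : ∀ i, 0 ≤ piExp q (f i) := fun i => piExp_nonneg h0 (hf0 i)
  -- With `N = ∑ f` and `B = ∑ f g`, failure means `N - B < μ / 4`, so `B ≥ μ / 4` or `N < μ / 2`.
  -- The two terms are the Markov and Chebyshev bounds for these cases.
  have hpt : ∀ ω, (if μ / 4 ≤ ∑ i ∈ A, f i ω * (1 - g i ω) then (0 : ℝ) else 1)
      ≤ (4 / μ ^ 2) * ((∑ i ∈ A, f i ω) ^ 2 + ((-2 * μ) * (∑ i ∈ A, f i ω) + μ ^ 2))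
        + (4 / μ) * ∑ i ∈ A, f i ω * g i ω := by
    intro ω
    have hB : 0 ≤ ∑ i ∈ A, f i ω * g i ω :=
      Finset.sum_nonneg fun i _ => mul_nonneg (hf0 i ω) (hg i ω)
    have hs : ∑ i ∈ A, f i ω * (1 - g i ω)
        = (∑ i ∈ A, f i ω) - ∑ i ∈ A, f i ω * g i ω := by
      rw [← Finset.sum_sub_distrib]
      exact Finset.sum_congr rfl fun _ _ => by ring
    rw [hs]
    set N := ∑ i ∈ A, f i ω
    set B := ∑ i ∈ A, f i ω * g i ω
    have hsq : N ^ 2 + ((-2 * μ) * N + μ ^ 2) = (N - μ) ^ 2 := by ring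
    rw [hsq]
    have k1 : 0 ≤ 4 / μ ^ 2 * (N - μ) ^ 2 := by positivity
    have k2 : 0 ≤ 4 / μ * B := by positivity
    split_ifs with h
    · linarith
    · push Not at h
      by_cases hB4 : μ / 4 ≤ B
      · have : 1 ≤ 4 / μ * B := by
          rw [div_mul_eq_mul_div, one_le_div hμ0]
          linarith
        linarith
      · have : 1 ≤ 4 / μ ^ 2 * (N - μ) ^ 2 := by
          rw [div_mul_eq_mul_div, one_le_div (by positivity)]
          nlinarith
        linarith
  have h := piExp_mono h0 hpt
  refine h.trans ?_
  have hsecond : piExp q (fun ω => (∑ i ∈ A, f i ω) ^ 2) ≤ μ + μ ^ 2 := by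
    have e1 : piExp q (fun ω => (∑ i ∈ A, f i ω) ^ 2)
        = ∑ i ∈ A, ∑ j ∈ A, piExp q (fun ω => f i ω * f j ω) := by
      simp_rw [sq, Finset.sum_mul_sum, piExp_sum]
    rw [e1]
    have e2 : ∀ i ∈ A, ∑ j ∈ A, piExp q (fun ω => f i ω * f j ω)
        ≤ piExp q (f i) + piExp q (f i) * μ := by
      intro i hi
      have e3 : ∀ j ∈ A, piExp q (fun ω => f i ω * f j ω)
          ≤ (if i = j then piExp q (f i) else 0) + piExp q (f i) * piExp q (f j) := by
        intro j hj
        by_cases hij : i = j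
        · subst hij
          simp only [hff1, if_true]
          nlinarith [hE0 i]
        · rw [hff i hi j hj hij, if_neg hij, zero_add]
      refine (Finset.sum_le_sum e3).trans (le_of_eq ?_)
      rw [Finset.sum_add_distrib, ← Finset.mul_sum, ← hμ]
      simp [hi]
    refine (Finset.sum_le_sum e2).trans (le_of_eq ?_)
    rw [Finset.sum_add_distrib, ← Finset.sum_mul, ← hμ]
    ring
  have hBexp : piExp q (fun ω => ∑ i ∈ A, f i ω * g i ω) ≤ ε * μ := by
    rw [piExp_sum, hμ, Finset.mul_sum]
    refine Finset.sum_le_sum fun i hi => ?_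
    rw [hfg i hi, mul_comm]
    exact mul_le_mul_of_nonneg_right (hε i hi) (hE0 i)
  rw [piExp_add, piExp_const_mul, piExp_const_mul, piExp_add, piExp_add, piExp_const_mul,
    piExp_const hq, piExp_sum, ← hμ]
  have l1 : 4 / μ ^ 2 * (piExp q (fun ω => (∑ i ∈ A, f i ω) ^ 2) + (-2 * μ * μ + μ ^ 2))
      ≤ 4 / μ ^ 2 * μ := mul_le_mul_of_nonneg_left (by nlinarith) (by positivity)
  have l2 : 4 / μ * piExp q (fun ω => ∑ i ∈ A, f i ω * g i ω) ≤ 4 / μ * (ε * μ) :=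
    mul_le_mul_of_nonneg_left hBexp (by positivity)
  have l3 : 4 / μ ^ 2 * μ = 4 / μ := by field_simp
  have l4 : 4 / μ * (ε * μ) = 4 * ε := by field_simp
  linarith

end ProductWeights

/-! ### Scalar inequalities for a log-likelihood ratio `u`. -/

section ExpInequalities

/-- This is `|v| ≤ |sinh v|` at `v = u / 4`, since `exp (u/2) - 1 = 2 exp (u/4) sinh (u/4)`. It lets
the Hellinger distance control the tilted second moment. -/
lemma exp_half_mul_sq_le (u : ℝ) :
    Real.exp (u / 2) * u ^ 2 ≤ 4 * (Real.exp (u / 2) - 1) ^ 2 := by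
  have h1 : u ^ 2 ≤ 4 * (Real.exp (u / 4) - Real.exp (-(u / 4))) ^ 2 := by
    have h2 : |u / 4| ≤ |Real.sinh (u / 4)| := by
      rw [Real.abs_sinh]
      exact Real.self_le_sinh_iff.2 (abs_nonneg _)
    have := sq_le_sq.2 h2
    rw [Real.sinh_eq] at this
    nlinarith
  have h3 : Real.exp (u / 2) = Real.exp (u / 4) ^ 2 := by rw [← Real.exp_nat_mul]; ring_nf
  have h4 : Real.exp (u / 4) * Real.exp (-(u / 4)) = 1 := by rw [← Real.exp_add]; simp
  have h5 : (Real.exp (u / 2) - 1) ^ 2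
      = Real.exp (u / 2) * (Real.exp (u / 4) - Real.exp (-(u / 4))) ^ 2 := by
    have : Real.exp (u / 2) - 1
        = Real.exp (u / 4) * (Real.exp (u / 4) - Real.exp (-(u / 4))) := by
      rw [mul_sub, h4, h3]; ring
    rw [this, mul_pow, h3]
  rw [h5]
  nlinarith [Real.exp_pos (u / 2)]

lemma abs_exp_sub_quadratic_le {x : ℝ} (hx : |x| ≤ 1) :
    |Real.exp x - (1 + x + x ^ 2 / 2)| ≤ 2 / 9 * |x| ^ 3 := by
  have h := Real.exp_bound hx (n := 3) (by norm_num)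
  norm_num [Finset.sum_range_succ, Nat.factorial] at h
  linarith

/-- The constant and quadratic terms of the two exponentials cancel, so the error is cubic; one
factor `|u|` is paid by `η`. -/
lemma abs_sub_exp_sub_exp_neg_le {u η : ℝ} (hη : η ≤ 1) (hu : |u| ≤ η) :
    |u - (Real.exp (u / 2) - Real.exp (-(u / 2)))| ≤ η * u ^ 2 := by
  have hu1 : |u / 2| ≤ 1 := by rw [abs_div]; norm_num; linarith
  have h1 := abs_exp_sub_quadratic_le hu1
  have h2 := abs_exp_sub_quadratic_le (x := -(u / 2)) (by rwa [abs_neg])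
  rw [abs_neg] at h2
  have h3 : |u / 2| ^ 3 ≤ η * u ^ 2 := by
    rw [abs_div, abs_two, ← sq_abs u]
    have := mul_le_mul_of_nonneg_right hu (sq_nonneg |u|)
    have h0 := mul_nonneg (abs_nonneg u) (sq_nonneg |u|)
    nlinarith
  have h0 : 0 ≤ |u / 2| ^ 3 := by positivity
  rw [abs_le] at h1 h2 ⊢
  constructor <;> nlinarith

/-- To leading order the squares are `u²/4` and `u²/2`: pointwise, the Hellinger integrand is half
the divergence integrand. -/
lemma exp_half_sub_one_sq_le {u η : ℝ} (hη : η ≤ 1 / 2) (hu : |u| ≤ η) :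
    (1 - η) * (Real.exp (u / 2) - 1) ^ 2 ≤ (1 + η) / 2 * (Real.exp u - 1 - u) := by
  have hu0 := abs_nonneg u
  have h1 : u ^ 2 / 2 * (1 - η) ≤ Real.exp u - 1 - u := by
    have h := (abs_le.1 (abs_exp_sub_quadratic_le (x := u) (by linarith))).1
    have h3 : |u| ^ 3 ≤ η * u ^ 2 := by
      rw [← sq_abs u]
      have := mul_le_mul_of_nonneg_right hu (sq_nonneg |u|)
      linarith [show |u| ^ 3 = |u| * |u| ^ 2 by ring]
    nlinarith [mul_nonneg (hu0.trans hu) (sq_nonneg u)]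
  have h2 : (Real.exp (u / 2) - 1) ^ 2 ≤ u ^ 2 / 4 * (1 + η) := by
    have hv : |u / 2| = |u| / 2 := by rw [abs_div, abs_two]
    have h := Real.exp_bound (x := u / 2) (by rw [hv]; linarith) (n := 2) (by norm_num)
    norm_num [Finset.sum_range_succ, Nat.factorial] at h
    have h4 : |Real.exp (u / 2) - 1| ≤ |u| / 2 * (1 + 3 / 8 * η) := by
      have h5 : Real.exp (u / 2) - 1 = (Real.exp (u / 2) - (1 + u / 2)) + u / 2 := by ring
      rw [h5]
      refine (abs_add_le _ _).trans ?_
      rw [hv]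
      have : (u / 2) ^ 2 = |u| / 2 * (|u| / 2) := by rw [← sq_abs, hv]; ring
      rw [this] at h
      nlinarith [mul_le_mul_of_nonneg_left hu hu0]
    have h6 := pow_le_pow_left₀ (abs_nonneg _) h4 2
    rw [sq_abs] at h6
    have h7 : (|u| / 2 * (1 + 3 / 8 * η)) ^ 2 = u ^ 2 / 4 * (1 + 3 / 8 * η) ^ 2 := by
      rw [mul_pow, div_pow, sq_abs]; ring
    rw [h7] at h6
    refine h6.trans (mul_le_mul_of_nonneg_left ?_ (by positivity))
    nlinarith [hu0.trans hu]
  have h8 := mul_le_mul_of_nonneg_left h2 (show 0 ≤ 1 - η by linarith)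
  have h9 := mul_le_mul_of_nonneg_left h1 (show 0 ≤ (1 + η) / 2 by linarith)
  nlinarith

/-- The function `exp u - 1 - u` is monotone on each side of `0` and already exceeds `η²/4` at `±η`.
-/
lemma abs_le_of_exp_sub_one_sub_le {u η : ℝ} (h0 : 0 < η) (hη : η ≤ 1)
    (hu : Real.exp u - 1 - u ≤ η ^ 2 / 4) : |u| ≤ η := by
  by_contra! h
  rcases lt_abs.1 h with h | h
  · have := Real.quadratic_le_exp_of_nonneg (h0.trans h).le
    nlinarith
  · have h1 := (abs_le.1 (abs_exp_sub_quadratic_le (x := -η)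
      (by rw [abs_neg, abs_of_pos h0]; exact hη))).1
    rw [abs_neg, abs_of_pos h0] at h1
    have h2 : Real.exp (-η) + (u + η) ≤ Real.exp u := by
      have e : Real.exp u = Real.exp (-η) * Real.exp (u + η) := by
        rw [← Real.exp_add]; ring_nf
      rw [e]
      have := Real.add_one_le_exp (u + η)
      have h3 : Real.exp (-η) ≤ 1 := Real.exp_le_one_iff.2 (by linarith)
      nlinarith [mul_le_mul_of_nonneg_left this (Real.exp_pos (-η)).le]
    nlinarith [pow_pos h0 2, pow_pos h0 3,
      show η ^ 3 ≤ η ^ 2 by nlinarith [pow_pos h0 2]]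

end ExpInequalities

/-! ### Close pairs of laws on the output set. -/

section Laws

variable {Y : Type*} [Fintype Y]

/-- Two positive laws whose squared Hellinger distance is at most `h` and whose log-likelihood
ratio is bounded by `η`. -/
structure IsClosePair (P Q : PMF Y) (h η : ℝ) : Prop where
  pos_left : ∀ y, 0 < (P y).toReal
  pos_right : ∀ y, 0 < (Q y).toReal
  hellinger : ∑ y, (√(P y).toReal - √(Q y).toReal) ^ 2 ≤ 2 * h
  abs_log : ∀ y, |Real.log ((Q y).toReal / (P y).toReal)| ≤ η

lemma sum_toReal (P : PMF Y) : ∑ y, (P y).toReal = 1 := by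
  rw [← ENNReal.toReal_sum fun y _ => P.apply_ne_top y]
  have h : ∑ y, P y = 1 := (tsum_fintype (fun y => P y)).symm.trans P.tsum_coe
  rw [h, ENNReal.toReal_one]

variable {P Q : PMF Y} {h η : ℝ}

lemma IsClosePair.symm (H : IsClosePair P Q h η) : IsClosePair Q P h η where
  pos_left := H.pos_right
  pos_right := H.pos_left
  hellinger := by
    refine le_trans (le_of_eq (Finset.sum_congr rfl fun y _ => ?_)) H.hellinger
    ring
  abs_log y := by
    rw [← inv_div, Real.log_inv, abs_neg]
    exact H.abs_log y

omit [Fintype Y] in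
lemma map_perm_apply (P : PMF Y) (τ : Equiv.Perm Y) (y : Y) : (P.map τ) (τ y) = P y := by
  classical
  rw [PMF.map_apply, tsum_eq_single y]
  · simp
  · intro z hz
    rw [if_neg]
    exact fun h => hz (τ.injective h).symm

lemma IsClosePair.of_map {τ : Equiv.Perm Y} (H : IsClosePair (P.map τ) (Q.map τ) h η) :
    IsClosePair P Q h η where
  pos_left y := by simpa only [map_perm_apply] using H.pos_left (τ y)
  pos_right y := by simpa only [map_perm_apply] using H.pos_right (τ y)
  hellinger := by
    have := H.hellinger
    rw [← Equiv.sum_comp τ] at this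
    simpa only [map_perm_apply] using this
  abs_log y := by simpa only [map_perm_apply] using H.abs_log (τ y)

lemma IsClosePair.map (H : IsClosePair P Q h η) (τ : Equiv.Perm Y) :
    IsClosePair (P.map τ) (Q.map τ) h η := by
  have key : ∀ R : PMF Y, (R.map τ).map τ.symm = R := fun R => by
    rw [PMF.map_comp]
    simp [PMF.map_id]
  refine IsClosePair.of_map (τ := τ.symm) ?_
  rwa [key, key]

lemma mul_exp_log_div {a b : ℝ} (ha : 0 < a) (hb : 0 < b) : a * Real.exp (Real.log (b / a)) = b := by
  rw [Real.exp_log (div_pos hb ha)]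
  field_simp

lemma sqrt_sub_sqrt_sq_eq {a b : ℝ} (ha : 0 < a) (hb : 0 < b) :
    (√a - √b) ^ 2 = a * (Real.exp (Real.log (b / a) / 2) - 1) ^ 2 := by
  have h1 : √b = √a * Real.exp (Real.log (b / a) / 2) := by
    rw [Real.exp_half, Real.exp_log (div_pos hb ha), ← Real.sqrt_mul ha.le]
    congr 1
    field_simp
  rw [h1]
  have := Real.sq_sqrt ha.le
  calc _ = √a ^ 2 * (Real.exp (Real.log (b / a) / 2) - 1) ^ 2 := by ring
    _ = _ := by rw [this]

/-- The log-likelihood ratio `log (Q y / P y)`. -/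
noncomputable def llr (P Q : PMF Y) (y : Y) : ℝ := Real.log ((Q y).toReal / (P y).toReal)

lemma IsClosePair.mul_exp_llr (H : IsClosePair P Q h η) (y : Y) :
    (P y).toReal * Real.exp (llr P Q y) = (Q y).toReal :=
  mul_exp_log_div (H.pos_left y) (H.pos_right y)

lemma IsClosePair.sum_sq_le (H : IsClosePair P Q h η) :
    ∑ y, (P y).toReal * (Real.exp (llr P Q y / 2) - 1) ^ 2 ≤ 2 * h := by
  refine le_trans (le_of_eq (Finset.sum_congr rfl fun y _ => ?_)) H.hellinger
  exact (sqrt_sub_sqrt_sq_eq (H.pos_left y) (H.pos_right y)).symm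

lemma IsClosePair.nonneg (H : IsClosePair P Q h η) : 0 ≤ h := by
  have : 0 ≤ ∑ y, (√(P y).toReal - √(Q y).toReal) ^ 2 := Finset.sum_nonneg fun _ _ => sq_nonneg _
  linarith [H.hellinger]

lemma exp_half_sq (u : ℝ) : Real.exp (u / 2) ^ 2 = Real.exp u := by
  rw [← Real.exp_nat_mul]; ring_nf

/-- The sum is the Bhattacharyya coefficient, and expanding the square gives Hellinger sum `= 2 - 2
* coefficient`. -/
lemma IsClosePair.sum_exp_half_ge (H : IsClosePair P Q h η) :
    1 - h ≤ ∑ y, (P y).toReal * Real.exp (llr P Q y / 2) := by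
  have h1 : ∑ y, (P y).toReal * (Real.exp (llr P Q y / 2) - 1) ^ 2
      = ∑ y, (Q y).toReal - 2 * (∑ y, (P y).toReal * Real.exp (llr P Q y / 2))
        + ∑ y, (P y).toReal := by
    rw [Finset.mul_sum, ← Finset.sum_sub_distrib, ← Finset.sum_add_distrib]
    refine Finset.sum_congr rfl fun y _ => ?_
    rw [← H.mul_exp_llr y, ← exp_half_sq (llr P Q y)]
    ring
  have h2 := H.sum_sq_le
  rw [h1, sum_toReal, sum_toReal] at h2
  linarith

lemma IsClosePair.sum_exp_half_mul_sq_le (H : IsClosePair P Q h η) :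
    ∑ y, (P y).toReal * Real.exp (llr P Q y / 2) * llr P Q y ^ 2 ≤ 8 * h := by
  calc _ ≤ ∑ y, 4 * ((P y).toReal * (Real.exp (llr P Q y / 2) - 1) ^ 2) := by
        refine Finset.sum_le_sum fun y _ => ?_
        have := mul_le_mul_of_nonneg_left (exp_half_mul_sq_le (llr P Q y)) (H.pos_left y).le
        linarith
    _ ≤ 8 * h := by
        rw [← Finset.mul_sum]
        linarith [H.sum_sq_le]

/-- Replacing `u` by `exp (u/2) - exp (-u/2)` turns each term into `Q y - P y`, which sums to zero.
Only the cubic error survives, so the geometric mean nearly centres `u`. -/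
lemma IsClosePair.abs_sum_exp_half_mul_le (H : IsClosePair P Q h η) (hη0 : 0 ≤ η) (hη : η ≤ 1) :
    |∑ y, (P y).toReal * Real.exp (llr P Q y / 2) * llr P Q y| ≤ 8 * η * h := by
  have h1 : ∑ y, (P y).toReal * Real.exp (llr P Q y / 2) * llr P Q y
      = ∑ y, (P y).toReal * Real.exp (llr P Q y / 2)
        * (llr P Q y - (Real.exp (llr P Q y / 2) - Real.exp (-(llr P Q y / 2)))) := by
    have h2 : ∀ y, (P y).toReal * Real.exp (llr P Q y / 2)
        * (llr P Q y - (Real.exp (llr P Q y / 2) - Real.exp (-(llr P Q y / 2))))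
        = (P y).toReal * Real.exp (llr P Q y / 2) * llr P Q y
          - ((Q y).toReal - (P y).toReal) := by
      intro y
      have h3 : Real.exp (llr P Q y / 2) * Real.exp (-(llr P Q y / 2)) = 1 := by
        rw [← Real.exp_add]; simp
      rw [← H.mul_exp_llr y, ← exp_half_sq (llr P Q y)]
      linear_combination (P y).toReal * h3
    simp only [h2]
    rw [Finset.sum_sub_distrib, Finset.sum_sub_distrib, sum_toReal, sum_toReal]
    ring
  rw [h1]
  calc _ ≤ ∑ y, η * ((P y).toReal * Real.exp (llr P Q y / 2) * llr P Q y ^ 2) := by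
        refine (Finset.abs_sum_le_sum_abs _ _).trans (Finset.sum_le_sum fun y _ => ?_)
        have hp : 0 ≤ (P y).toReal * Real.exp (llr P Q y / 2) :=
          mul_nonneg (H.pos_left y).le (Real.exp_pos _).le
        rw [abs_mul, abs_of_nonneg hp]
        have := mul_le_mul_of_nonneg_left (abs_sub_exp_sub_exp_neg_le hη (H.abs_log y)) hp
        unfold llr at this ⊢
        linarith
    _ ≤ 8 * η * h := by
        rw [← Finset.mul_sum]
        nlinarith [mul_le_mul_of_nonneg_left H.sum_exp_half_mul_sq_le hη0]

/-- A chi-square bound: with `a = exp (u/2)` and `a' = 1/a`, `(a - a')² = (a - 1)² (1 + a')²`, and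
`a' ≤ 2` gives the factor `9`. -/
lemma IsClosePair.sum_exp_neg_le (H : IsClosePair P Q h η) (hη : η ≤ 1) :
    ∑ y, (P y).toReal * Real.exp (-llr P Q y) ≤ 1 + 18 * h := by
  have h1 : ∀ y, (P y).toReal * Real.exp (-llr P Q y)
      ≤ 9 * ((P y).toReal * (Real.exp (llr P Q y / 2) - 1) ^ 2)
        + (2 * (P y).toReal - (Q y).toReal) := by
    intro y
    set u := llr P Q y with hu
    set a := Real.exp (u / 2) with ha
    set a' := Real.exp (-(u / 2)) with ha'
    have haa : a * a' = 1 := by rw [ha, ha', ← Real.exp_add]; simp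
    have e1 : Real.exp u = a ^ 2 := (exp_half_sq u).symm
    have e2 : Real.exp (-u) = a' ^ 2 := by
      rw [ha', ← neg_div, exp_half_sq]
    have hab := abs_le.1 (H.abs_log y)
    have ha2 : a' ≤ 2 := by
      have h3 : a' ≤ Real.exp (1 / 2) := Real.exp_le_exp.2 (by
        have : -η ≤ u := hab.1
        linarith)
      have h4 : Real.exp (1 / 2) ^ 2 ≤ 2 ^ 2 := by
        rw [exp_half_sq]; linarith [Real.exp_one_lt_d9]
      exact h3.trans ((sq_le_sq₀ (Real.exp_pos _).le (by norm_num)).1 h4)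
    have ha0 : 0 < a' := Real.exp_pos _
    have key : a' ^ 2 - 2 + a ^ 2 ≤ 9 * (a - 1) ^ 2 := by
      have : a' ^ 2 - 2 + a ^ 2 = (a - 1) ^ 2 * (1 + a') ^ 2 := by
        have : (a - 1) * (1 + a') = a - a' := by linear_combination haa
        rw [← mul_pow, this]
        linear_combination (2 : ℝ) * haa
      rw [this]
      nlinarith [sq_nonneg (a - 1), show (1 + a') ^ 2 ≤ 9 by nlinarith]
    rw [← H.mul_exp_llr y, ← hu, e1, e2]
    nlinarith [mul_le_mul_of_nonneg_left key (H.pos_left y).le]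
  refine (Finset.sum_le_sum fun y _ => h1 y).trans ?_
  rw [Finset.sum_add_distrib, Finset.sum_sub_distrib, ← Finset.mul_sum, ← Finset.mul_sum,
    sum_toReal, sum_toReal]
  linarith [H.sum_sq_le]

/-- Adding `Q y - P y`, of total sum zero, makes every term nonnegative; hence each term alone is
bounded by the divergence. -/
lemma kl_eq_sum (hP : ∀ y, 0 < (P y).toReal) (hQ : ∀ y, 0 < (Q y).toReal) :
    kl P Q = ∑ y, (P y).toReal * (Real.exp (llr P Q y) - 1 - llr P Q y) := by
  have h1 : ∀ y, (P y).toReal * (Real.exp (llr P Q y) - 1 - llr P Q y)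
      = (P y).toReal * Real.log ((P y).toReal / (Q y).toReal) + ((Q y).toReal - (P y).toReal) := by
    intro y
    have h2 : llr P Q y = -Real.log ((P y).toReal / (Q y).toReal) := by
      rw [llr, ← inv_div, Real.log_inv]
    have h3 : (P y).toReal * Real.exp (llr P Q y) = (Q y).toReal := mul_exp_log_div (hP y) (hQ y)
    rw [mul_sub, mul_sub, h3, h2]
    ring
  simp only [h1]
  rw [Finset.sum_add_distrib, Finset.sum_sub_distrib, sum_toReal, sum_toReal]
  simp [kl]

lemma kl_nonneg (hP : ∀ y, 0 < (P y).toReal) (hQ : ∀ y, 0 < (Q y).toReal) : 0 ≤ kl P Q := by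
  rw [kl_eq_sum hP hQ]
  refine Finset.sum_nonneg fun y _ => mul_nonneg (hP y).le ?_
  linarith [Real.add_one_le_exp (llr P Q y)]

/-- Laws bounded below with a small divergence form a close pair, whose squared Hellinger distance
is nearly a quarter of the divergence. -/
lemma isClosePair_of_kl_le {κ : ℝ} (hκ : 0 < κ) (hP : ∀ y, κ ≤ (P y).toReal)
    (hQ : ∀ y, κ ≤ (Q y).toReal) (hη0 : 0 < η) (hη : η ≤ 1 / 2)
    (hK : kl P Q ≤ κ * (η ^ 2 / 4)) :
    IsClosePair P Q ((1 + η) / (1 - η) * kl P Q / 4) η := by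
  have hP0 : ∀ y, 0 < (P y).toReal := fun y => hκ.trans_le (hP y)
  have hQ0 : ∀ y, 0 < (Q y).toReal := fun y => hκ.trans_le (hQ y)
  have hφ : ∀ y, 0 ≤ Real.exp (llr P Q y) - 1 - llr P Q y := fun y => by
    linarith [Real.add_one_le_exp (llr P Q y)]
  have hu : ∀ y, |llr P Q y| ≤ η := by
    intro y
    refine abs_le_of_exp_sub_one_sub_le hη0 (by linarith) ?_
    have h1 : (P y).toReal * (Real.exp (llr P Q y) - 1 - llr P Q y) ≤ kl P Q := by
      rw [kl_eq_sum hP0 hQ0]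
      exact Finset.single_le_sum
        (f := fun y => (P y).toReal * (Real.exp (llr P Q y) - 1 - llr P Q y))
        (fun z _ => mul_nonneg (hP0 z).le (hφ z)) (Finset.mem_univ y)
    have h2 := mul_le_mul_of_nonneg_right (hP y) (hφ y)
    exact le_of_mul_le_mul_left (h2.trans (h1.trans hK)) hκ
  refine ⟨hP0, hQ0, ?_, hu⟩
  have h3 : (1 - η) * ∑ y, (√(P y).toReal - √(Q y).toReal) ^ 2 ≤ (1 + η) / 2 * kl P Q := by
    rw [kl_eq_sum hP0 hQ0, Finset.mul_sum, Finset.mul_sum]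
    refine Finset.sum_le_sum fun y _ => ?_
    rw [sqrt_sub_sqrt_sq_eq (hP0 y) (hQ0 y)]
    have := mul_le_mul_of_nonneg_left (exp_half_sub_one_sq_le hη (hu y)) (hP0 y).le
    unfold llr at this ⊢
    linarith
  have h4 : 0 < 1 - η := by linarith
  rw [show 2 * ((1 + η) / (1 - η) * kl P Q / 4) = (1 + η) / 2 * kl P Q / (1 - η) by
    field_simp; ring, le_div_iff₀ h4]
  linarith

end Laws

/-! ### Randomly sampled pairs: an unsampled pair has ratio `1`, so deviations scale by `p`. -/

section EdgeLaws

variable {Y : Type*} [Fintype Y]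

/-- The weights of `edgeLaw` as real numbers. -/
noncomputable def edgeWeight (p : ℝ) (P : PMF Y) : Option Y → ℝ
  | none => 1 - p
  | some y => p * (P y).toReal

/-- The log-likelihood ratio of two edge laws. -/
noncomputable def edgeLlr (P Q : PMF Y) : Option Y → ℝ
  | none => 0
  | some y => llr P Q y

lemma edgeLaw_toReal (p : unitInterval) (P : PMF Y) (o : Option Y) :
    (edgeLaw p P o).toReal = edgeWeight p P o := by
  cases o with
  | none => simp [edgeLaw, edgeWeight]
  | some y => simp [edgeLaw, edgeWeight]

lemma sum_edgeWeight_mul (p : ℝ) (P : PMF Y) (f : Option Y → ℝ) :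
    ∑ o, edgeWeight p P o * f o = (1 - p) * f none + p * ∑ y, (P y).toReal * f (some y) := by
  rw [Fintype.sum_option, Finset.mul_sum]
  simp only [edgeWeight, mul_assoc]

lemma sum_edgeWeight (p : ℝ) (P : PMF Y) : ∑ o, edgeWeight p P o = 1 := by
  have := sum_edgeWeight_mul p P (fun _ => 1)
  simpa [sum_toReal] using this

lemma edgeWeight_nonneg (p : unitInterval) (P : PMF Y) (o : Option Y) :
    0 ≤ edgeWeight p P o := by
  rw [← edgeLaw_toReal]
  exact ENNReal.toReal_nonneg

variable {P Q : PMF Y} {h η : ℝ} (p : unitInterval)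

lemma IsClosePair.edgeWeight_mul_exp (H : IsClosePair P Q h η) (o : Option Y) :
    edgeWeight p P o * Real.exp (edgeLlr P Q o) = edgeWeight p Q o := by
  cases o with
  | none => simp [edgeWeight, edgeLlr]
  | some y => simp only [edgeWeight, edgeLlr, mul_assoc, H.mul_exp_llr]

lemma IsClosePair.edge_sum_exp_half_ge (H : IsClosePair P Q h η) :
    1 - p * h ≤ ∑ o, edgeWeight p P o * Real.exp (edgeLlr P Q o / 2) := by
  rw [sum_edgeWeight_mul p P fun o => Real.exp (edgeLlr P Q o / 2)]
  simp only [edgeLlr, zero_div, Real.exp_zero]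
  nlinarith [mul_le_mul_of_nonneg_left H.sum_exp_half_ge p.2.1]

lemma IsClosePair.edge_abs_sum_exp_half_mul_le (H : IsClosePair P Q h η) (hη0 : 0 ≤ η)
    (hη : η ≤ 1) :
    |∑ o, edgeWeight p P o * Real.exp (edgeLlr P Q o / 2) * edgeLlr P Q o|
      ≤ 8 * η * (p * h) := by
  have e := sum_edgeWeight_mul p P fun o => Real.exp (edgeLlr P Q o / 2) * edgeLlr P Q o
  simp only [← mul_assoc] at e
  rw [e]
  simp only [edgeLlr, mul_zero, zero_add]
  rw [abs_mul, abs_of_nonneg p.2.1]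
  nlinarith [mul_le_mul_of_nonneg_left (H.abs_sum_exp_half_mul_le hη0 hη) p.2.1]

lemma IsClosePair.edge_sum_exp_half_mul_sq_le (H : IsClosePair P Q h η) :
    ∑ o, edgeWeight p P o * Real.exp (edgeLlr P Q o / 2) * edgeLlr P Q o ^ 2 ≤ 8 * (p * h) := by
  have e := sum_edgeWeight_mul p P fun o => Real.exp (edgeLlr P Q o / 2) * edgeLlr P Q o ^ 2
  simp only [← mul_assoc] at e
  rw [e]
  simp only [edgeLlr]
  nlinarith [mul_le_mul_of_nonneg_left H.sum_exp_half_mul_sq_le p.2.1]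

lemma IsClosePair.edge_sum_exp_neg_le (H : IsClosePair P Q h η) (hη : η ≤ 1) :
    ∑ o, edgeWeight p P o * Real.exp (-edgeLlr P Q o) ≤ 1 + 18 * (p * h) := by
  rw [sum_edgeWeight_mul p P fun o => Real.exp (-edgeLlr P Q o)]
  simp only [edgeLlr, neg_zero, Real.exp_zero]
  nlinarith [mul_le_mul_of_nonneg_left (H.sum_exp_neg_le hη) p.2.1]

end EdgeLaws

/-! ### From minimax error to posterior mass. -/

section Bayes

lemma toOuterMeasure_le_one {α : Type*} (p : PMF α) (s : Set α) : p.toOuterMeasure s ≤ 1 := by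
  rw [PMF.toOuterMeasure_apply, ← p.tsum_coe]
  exact ENNReal.tsum_le_tsum fun a => Set.indicator_le_self s p a

variable {m n : ℕ} {Y : Type*} [Fintype Y]

/-- The minimum over shifts is attained; `0 < n` makes the prefactor `1 / n` positive. -/
lemma exists_eq_add_of_not_mcr_pos [NeZero m] (hn : 0 < n) {xhat x : Fin n → ZMod m}
    (h : ¬ 0 < mcr xhat x) : ∃ l : ZMod m, xhat = fun i => x i + l := by
  by_contra! hne
  refine h (mul_pos (by positivity) ?_)
  obtain ⟨l, hl⟩ := exists_eq_ciInf_of_finite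
    (f := fun l : ZMod m => (hammingDist xhat (fun i => x i + l) : ℝ))
  rw [← hl]
  exact_mod_cast hammingDist_pos.2 (hne l)

lemma errorProb_toReal (p : unitInterval) (P : ZMod m → PMF Y) [NeZero m] (g : Estimator m n Y)
    (x : Fin n → ZMod m) :
    (errorProb p P g x).toReal
      = ∑ ω, (obsLaw p P x ω).toReal
        * ∑ z, {xhat | 0 < mcr xhat x}.indicator (fun z => (g ω z).toReal) z := by
  rw [errorProb, PMF.toOuterMeasure_bind_apply, tsum_fintype, ENNReal.toReal_sum]
  · refine Finset.sum_congr rfl fun ω _ => ?_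
    rw [ENNReal.toReal_mul, PMF.toOuterMeasure_apply_fintype, ENNReal.toReal_sum]
    · congr 1
      refine Finset.sum_congr rfl fun z _ => ?_
      by_cases hz : z ∈ {xhat | 0 < mcr xhat x}
      · simp only [Set.indicator_of_mem hz]
      · simp only [Set.indicator_of_notMem hz, ENNReal.toReal_zero]
    · intro z _
      by_cases hz : z ∈ {xhat | 0 < mcr xhat x}
      · simp only [Set.indicator_of_mem hz]
        exact (g ω).apply_ne_top z
      · simp only [Set.indicator_of_notMem hz]
        exact ENNReal.zero_ne_top
  · intro ω _
    refine ENNReal.mul_ne_top ((obsLaw p P x).apply_ne_top ω) ?_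
    exact ((toOuterMeasure_le_one _ _).trans_lt ENNReal.one_lt_top).ne

lemma errorProb_le_one (p : unitInterval) (P : ZMod m → PMF Y) (g : Estimator m n Y)
    (x : Fin n → ZMod m) : errorProb p P g x ≤ 1 :=
  toOuterMeasure_le_one _ _

lemma minimaxError_le_one (n : ℕ) (p : unitInterval) (P : ZMod m → PMF Y) :
    minimaxError n p P ≤ 1 :=
  iInf_le_of_le (fun _ => PMF.pure 0) (iSup_le fun x => errorProb_le_one p P _ x)

lemma one_sub_le_errorProb_toReal [NeZero m] (hn : 0 < n) (p : unitInterval) (P : ZMod m → PMF Y)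
    (g : Estimator m n Y) (x : Fin n → ZMod m) :
    1 - ∑ ω, (obsLaw p P x ω).toReal * ∑ l : ZMod m, (g ω fun i => x i + l).toReal
      ≤ (errorProb p P g x).toReal := by
  classical
  rw [errorProb_toReal, sub_le_iff_le_add, ← Finset.sum_add_distrib, ← sum_toReal (obsLaw p P x)]
  refine Finset.sum_le_sum fun ω _ => ?_
  rw [← mul_add]
  refine le_mul_of_one_le_right ENNReal.toReal_nonneg ?_
  have h2 : ∑ l : ZMod m, (g ω fun i => x i + l).toReal
      = ∑ z, ∑ l : ZMod m, if z = (fun i => x i + l) then (g ω z).toReal else 0 := by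
    rw [Finset.sum_comm]
    simp
  rw [h2, ← Finset.sum_add_distrib, ← sum_toReal (g ω)]
  refine Finset.sum_le_sum fun z _ => ?_
  have h3 : ∀ l : ZMod m, 0 ≤ if z = (fun i => x i + l) then (g ω z).toReal else 0 := fun l => by
    split_ifs
    · exact ENNReal.toReal_nonneg
    · exact le_rfl
  by_cases hz : 0 < mcr z x
  · rw [Set.indicator_of_mem (by exact hz)]
    linarith [Finset.sum_nonneg fun l (_ : l ∈ (Finset.univ : Finset (ZMod m))) => h3 l]
  · rw [Set.indicator_of_notMem (by exact hz), zero_add]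
    obtain ⟨l, hl⟩ := exists_eq_add_of_not_mcr_pos hn hz
    have := Finset.single_le_sum (fun l _ => h3 l) (Finset.mem_univ l)
    rwa [if_pos hl] at this

open Classical in
/-- A Bayesian bound: for a uniform prior on `X`, if with high probability the truth carries at most
a fraction `1 / T` of the posterior mass, every estimator errs with high probability. -/
lemma exists_errorProb_ge [NeZero m] (hn : 0 < n) (p : unitInterval) (P : ZMod m → PMF Y)
    (g : Estimator m n Y) {X : Finset (Fin n → ZMod m)} (hX : X.Nonempty)
    (G : (Fin n → ZMod m) → Obs n Y → Prop) {T β : ℝ} (hT : 0 < T)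
    (hG : ∀ x ∈ X, ∀ ω, G x ω →
      T * (obsLaw p P x ω).toReal ≤ ∑ x' ∈ X, (obsLaw p P x' ω).toReal)
    (hβ : ∀ x ∈ X, ∑ ω, (obsLaw p P x ω).toReal * (if G x ω then 0 else 1) ≤ β) :
    ∃ x ∈ X, 1 - (β + m / T) ≤ (errorProb p P g x).toReal := by
  set s : (Fin n → ZMod m) → Obs n Y → ℝ := fun x ω => ∑ l : ZMod m, (g ω fun i => x i + l).toReal
    with hs
  have hs0 : ∀ x ω, 0 ≤ s x ω := fun x ω => Finset.sum_nonneg fun _ _ => ENNReal.toReal_nonneg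
  have hM0 : ∀ ω, 0 ≤ ∑ x' ∈ X, (obsLaw p P x' ω).toReal :=
    fun ω => Finset.sum_nonneg fun _ _ => ENNReal.toReal_nonneg
  -- For fixed `l`, distinct `x` give distinct shifted states. Summed over `l`, the success weights
  -- on `X` total at most `m`.
  have hshift : ∀ ω (l : ZMod m), ∑ x ∈ X, (g ω fun i => x i + l).toReal ≤ 1 := by
    intro ω l
    rw [← sum_toReal (g ω),
      ← Equiv.sum_comp (Equiv.addRight (fun _ : Fin n => l)) fun z => (g ω z).toReal]
    exact Finset.sum_le_sum_of_subset_of_nonneg (Finset.subset_univ X)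
      fun _ _ _ => ENNReal.toReal_nonneg
  have hsX : ∀ ω, ∑ x ∈ X, s x ω ≤ m := by
    intro ω
    simp only [hs]
    rw [Finset.sum_comm]
    calc _ ≤ ∑ l : ZMod m, (1 : ℝ) := Finset.sum_le_sum fun l _ => hshift ω l
      _ = m := by simp [ZMod.card]
  have hs1 : ∀ x ω, s x ω ≤ 1 := by
    intro x ω
    have hinj : Function.Injective fun (l : ZMod m) (i : Fin n) => x i + l := fun a b hab =>
      add_left_cancel (congrFun hab ⟨0, hn⟩)
    rw [← sum_toReal (g ω)]
    simp only [hs]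
    rw [← Finset.sum_image (s := Finset.univ) (g := fun (l : ZMod m) (i : Fin n) => x i + l)
      (f := fun z => (g ω z).toReal) hinj.injOn]
    exact Finset.sum_le_sum_of_subset_of_nonneg (Finset.subset_univ _)
      fun _ _ _ => ENNReal.toReal_nonneg
  -- On `G` the weight of `x` is at most `1 / T` of the total; off `G` success is bounded by `1`.
  have hsucc : ∀ x ∈ X, ∀ ω, (obsLaw p P x ω).toReal * s x ω
      ≤ (obsLaw p P x ω).toReal * (if G x ω then 0 else 1)
        + (∑ x' ∈ X, (obsLaw p P x' ω).toReal) / T * s x ω := by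
    intro x hx ω
    have hw : 0 ≤ (obsLaw p P x ω).toReal := ENNReal.toReal_nonneg
    split_ifs with h
    · rw [mul_zero, zero_add]
      refine mul_le_mul_of_nonneg_right ?_ (hs0 x ω)
      rw [le_div_iff₀ hT, mul_comm]
      exact hG x hx ω h
    · have h1 := mul_le_mul_of_nonneg_left (hs1 x ω) hw
      have h2 := mul_nonneg (div_nonneg (hM0 ω) hT.le) (hs0 x ω)
      linarith
  have htotal : ∑ x ∈ X, ∑ ω, (obsLaw p P x ω).toReal * s x ω ≤ ∑ x ∈ X, (β + m / T) := by
    calc _ ≤ ∑ x ∈ X, ∑ ω, ((obsLaw p P x ω).toReal * (if G x ω then 0 else 1)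
          + (∑ x' ∈ X, (obsLaw p P x' ω).toReal) / T * s x ω) :=
          Finset.sum_le_sum fun x hx => Finset.sum_le_sum fun ω _ => hsucc x hx ω
      _ = (∑ x ∈ X, ∑ ω, (obsLaw p P x ω).toReal * (if G x ω then 0 else 1))
          + ∑ ω, (∑ x' ∈ X, (obsLaw p P x' ω).toReal) / T * ∑ x ∈ X, s x ω := by
          simp only [Finset.sum_add_distrib]
          congr 1
          rw [Finset.sum_comm]
          exact Finset.sum_congr rfl fun ω _ => (Finset.mul_sum _ _ _).symm
      _ ≤ (∑ x ∈ X, β) + ∑ ω, (∑ x' ∈ X, (obsLaw p P x' ω).toReal) / T * m :=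
          add_le_add (Finset.sum_le_sum hβ) (Finset.sum_le_sum fun ω _ =>
            mul_le_mul_of_nonneg_left (hsX ω) (div_nonneg (hM0 ω) hT.le))
      _ = ∑ x ∈ X, (β + m / T) := by
          rw [← Finset.sum_mul, ← Finset.sum_div, Finset.sum_comm, Finset.sum_add_distrib]
          simp only [sum_toReal, Finset.sum_const, nsmul_eq_mul, mul_one]
          ring
  obtain ⟨x, hx, hle⟩ := Finset.exists_le_of_sum_le hX htotal
  refine ⟨x, hx, le_trans ?_ (one_sub_le_errorProb_toReal hn p P g x)⟩
  linarith

end Bayes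

/-! ### The support of the prior and its single-index flips. -/

section Prior

variable {m n : ℕ} {Y : Type*} [Fintype Y]

/-- The states that are `0` from index `k` on and take values in `{0, l}` before. -/
def blockStates (n k : ℕ) (l : ZMod m) [NeZero m] : Finset (Fin n → ZMod m) :=
  {x | ∀ i, x i = 0 ∨ (i.1 < k ∧ x i = l)}

/-- Exchanging `0` and `l` at one index. -/
def flipAt (l : ZMod m) (x : Fin n → ZMod m) (i : Fin n) : Fin n → ZMod m :=
  Function.update x i (l - x i)

variable [NeZero m] {k : ℕ} {l : ZMod m} {x : Fin n → ZMod m}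

lemma mem_blockStates : x ∈ blockStates n k l ↔ ∀ i, x i = 0 ∨ (i.1 < k ∧ x i = l) := by
  simp [blockStates]

lemma blockStates_nonempty : (blockStates n k l).Nonempty :=
  ⟨0, mem_blockStates.2 fun _ => Or.inl rfl⟩

lemma flipAt_mem (hx : x ∈ blockStates n k l) {i : Fin n} (hi : i.1 < k) :
    flipAt l x i ∈ blockStates n k l := by
  rw [mem_blockStates] at hx ⊢
  intro j
  by_cases hj : j = i
  · subst hj
    rcases hx j with h | h <;> simp [flipAt, h, hi]
  · simpa [flipAt, hj] using hx j

-- Index `i` changes only under the flip at `i`, where `0` and `l` differ. Hence the likelihoods of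
-- the flips add up in the posterior normalization.
omit [NeZero m] in
lemma flipAt_injective (hl : l ≠ 0) (hx : ∀ i, x i = 0 ∨ x i = l) :
    Function.Injective (flipAt l x) := by
  intro i j hij
  by_contra hne
  have h := congrFun hij i
  simp only [flipAt, Function.update_self, Function.update_of_ne hne] at h
  rcases hx i with h' | h' <;> simp [h', hl, hl.symm] at h

omit [NeZero m] in
/-- The state difference across an edge is unchanged or moves between `0` and `±l`. -/
lemma diff_flipAt {R : ZMod m → ZMod m → Prop} (h1 : R 0 l) (h2 : R l 0) (h3 : R 0 (-l))
    (h4 : R (-l) 0) (hx : ∀ i, x i = 0 ∨ x i = l) (i : Fin n) (e : Pairs n) :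
    (e.1.1 ≠ i ∧ e.1.2 ≠ i ∧
      flipAt l x i e.1.1 - flipAt l x i e.1.2 = x e.1.1 - x e.1.2) ∨
    ((e.1.1 = i ∨ e.1.2 = i) ∧
      R (x e.1.1 - x e.1.2) (flipAt l x i e.1.1 - flipAt l x i e.1.2)) := by
  obtain ⟨⟨a, b⟩, hab⟩ := e
  have hne : a ≠ b := (ne_of_lt hab).symm
  dsimp only
  by_cases ha : a = i
  · subst ha
    right
    refine ⟨Or.inl rfl, ?_⟩
    simp only [flipAt, Function.update_self, Function.update_of_ne hne.symm]
    rcases hx a with h | h <;> rcases hx b with h' | h' <;> simp [h, h', h1, h2, h3, h4]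
  · by_cases hb : b = i
    · subst hb
      right
      refine ⟨Or.inr rfl, ?_⟩
      simp only [flipAt, Function.update_self, Function.update_of_ne hne]
      rcases hx a with h | h <;> rcases hx b with h' | h' <;> simp [h, h', h1, h2, h3, h4]
    · left
      exact ⟨ha, hb, by simp [flipAt, ha, hb]⟩

end Prior

/-! ### Counting the edges at one index. -/

section Edges

variable {n : ℕ}

lemma card_pairs_snd_le (i : Fin n) (s : Finset (Fin n)) :
    (Finset.univ.filter fun e : Pairs n => e.1.1 ∈ s ∧ e.1.2 = i).card ≤ s.card := by
  refine Finset.card_le_card_of_injOn (fun e => e.1.1) (fun e he => ?_) ?_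
  · exact (Finset.mem_filter.1 he).2.1
  · intro e he e' he' h
    have h1 := (Finset.mem_filter.1 he).2.2
    have h2 := (Finset.mem_filter.1 he').2.2
    exact Subtype.ext (Prod.ext h (h1.trans h2.symm))

lemma card_pairs_fst_le (i : Fin n) (s : Finset (Fin n)) :
    (Finset.univ.filter fun e : Pairs n => e.1.2 ∈ s ∧ e.1.1 = i).card ≤ s.card := by
  refine Finset.card_le_card_of_injOn (fun e => e.1.2) (fun e he => ?_) ?_
  · exact (Finset.mem_filter.1 he).2.1
  · intro e he e' he' h
    have h1 := (Finset.mem_filter.1 he).2.2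
    have h2 := (Finset.mem_filter.1 he').2.2
    exact Subtype.ext (Prod.ext (h1.trans h2.symm) h)

/-- The initial block of indices. -/
def block (n k : ℕ) : Finset (Fin n) := {i | i.1 < k}

lemma card_block {k : ℕ} (hk : k ≤ n) : (block n k).card = k := by
  rw [block, Fin.card_filter_val_lt, min_eq_right hk]

lemma mem_block {k : ℕ} {i : Fin n} : i ∈ block n k ↔ i.1 < k := by simp [block]

/-- The edges at `i` to larger indices outside the block. -/
def crossEdges (k : ℕ) (i : Fin n) : Finset (Pairs n) :=
  Finset.univ.filter fun e => ¬ e.1.1.1 < k ∧ e.1.2 = i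

/-- The edges at `i` inside the block. -/
def innerEdges (k : ℕ) (i : Fin n) : Finset (Pairs n) :=
  Finset.univ.filter fun e => e.1.1.1 < k ∧ (e.1.1 = i ∨ e.1.2 = i)

lemma card_crossEdges_le (k : ℕ) (i : Fin n) : (crossEdges k i).card ≤ n := by
  refine le_trans (Finset.card_le_card fun e he => ?_)
    ((card_pairs_snd_le i Finset.univ).trans (by simp))
  simpa using (Finset.mem_filter.1 he).2.2

lemma card_innerEdges_le {k : ℕ} (hk : k ≤ n) (i : Fin n) :
    (innerEdges k i).card ≤ 2 * k := by
  have h : innerEdges k i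
      ⊆ (Finset.univ.filter fun e : Pairs n => e.1.2 ∈ block n k ∧ e.1.1 = i)
        ∪ (Finset.univ.filter fun e : Pairs n => e.1.1 ∈ block n k ∧ e.1.2 = i) := by
    intro e he
    obtain ⟨h1, h2⟩ := (Finset.mem_filter.1 he).2
    -- The second index of a pair is the smaller one, so it lies in the block too.
    have h3 : e.1.2.1 < k := lt_trans e.2 h1
    simp only [Finset.mem_union, Finset.mem_filter, Finset.mem_univ, true_and, mem_block]
    tauto
  refine (Finset.card_le_card h).trans ((Finset.card_union_le _ _).trans ?_)
  have h1 := card_pairs_fst_le i (block n k)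
  have h2 := card_pairs_snd_le i (block n k)
  rw [card_block hk] at h1 h2
  omega

end Edges

/-! ### The lower bound at fixed `n`. -/

section LowerBound

variable {m n : ℕ} {Y : Type*} [Fintype Y]

lemma obsLaw_toReal (p : unitInterval) (P : ZMod m → PMF Y) (x : Fin n → ZMod m) (ω : Obs n Y) :
    (obsLaw p P x ω).toReal = ∏ e : Pairs n, edgeWeight p (P (x e.1.1 - x e.1.2)) (ω e) := by
  simp only [obsLaw, piLaw, PMF.ofFintype_apply, ENNReal.toReal_prod, edgeLaw_toReal]

omit [Fintype Y] in
lemma edgeLlr_self (P : PMF Y) (o : Option Y) : edgeLlr P P o = 0 := by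
  cases o with
  | none => rfl
  | some y =>
    simp only [edgeLlr, llr]
    by_cases h : (P y).toReal = 0
    · simp [h]
    · rw [div_self h, Real.log_one]

/-- The log-likelihood ratio across the edge `e` for exchanging `0` and `l` at `i`. -/
noncomputable def flipLlr (P : ZMod m → PMF Y) (l : ZMod m) (x : Fin n → ZMod m) (i : Fin n)
    (e : Pairs n) : Option Y → ℝ :=
  edgeLlr (P (x e.1.1 - x e.1.2)) (P (flipAt l x i e.1.1 - flipAt l x i e.1.2))

variable {k : ℕ} {l : ZMod m} {x : Fin n → ZMod m} {p : unitInterval}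
  {P : ZMod m → PMF Y} {h η : ℝ}

/-- The laws at `0` and at `±l` are close. -/
structure ClosePairs {m : ℕ} {Y : Type*} [Fintype Y] (P : ZMod m → PMF Y) (l : ZMod m) (h η : ℝ) : Prop where
  right : IsClosePair (P 0) (P l) h η
  left : IsClosePair (P 0) (P (-l)) h η

lemma ClosePairs.cases (H : ClosePairs P l h η) (hx : ∀ i, x i = 0 ∨ x i = l) (i : Fin n)
    (e : Pairs n) :
    (e.1.1 ≠ i ∧ e.1.2 ≠ i ∧
      flipAt l x i e.1.1 - flipAt l x i e.1.2 = x e.1.1 - x e.1.2) ∨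
    ((e.1.1 = i ∨ e.1.2 = i) ∧
      IsClosePair (P (x e.1.1 - x e.1.2)) (P (flipAt l x i e.1.1 - flipAt l x i e.1.2)) h η) :=
  diff_flipAt (R := fun a b => IsClosePair (P a) (P b) h η) H.right H.right.symm H.left
    H.left.symm hx i e

lemma ClosePairs.obsLaw_flipAt (H : ClosePairs P l h η) (hx : ∀ i, x i = 0 ∨ x i = l)
    (i : Fin n) (ω : Obs n Y) :
    (obsLaw p P (flipAt l x i) ω).toReal
      = (obsLaw p P x ω).toReal * Real.exp (∑ e, flipLlr P l x i e (ω e)) := by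
  rw [obsLaw_toReal, obsLaw_toReal, Real.exp_sum, ← Finset.prod_mul_distrib]
  refine Finset.prod_congr rfl fun e _ => ?_
  rcases H.cases hx i e with ⟨-, -, h'⟩ | ⟨-, h'⟩
  · rw [flipLlr, h', edgeLlr_self, Real.exp_zero, mul_one]
  · exact (h'.edgeWeight_mul_exp p (ω e)).symm

open Classical in
/-- The part of the log-likelihood ratio on the edges in `S`. -/
noncomputable def maskedLlr (P : ZMod m → PMF Y) (l : ZMod m) (x : Fin n → ZMod m) (i : Fin n)
    (S : Finset (Pairs n)) (e : Pairs n) (o : Option Y) : ℝ :=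
  if e ∈ S then flipLlr P l x i e o else 0

/-- Edges away from `i` contribute zero. An edge at `i` with larger end outside the block has `i` as
its smaller end, so it is a cross edge; all others at `i` are inner. -/
lemma ClosePairs.sum_flipLlr (H : ClosePairs P l h η) (hx : ∀ i, x i = 0 ∨ x i = l)
    {i : Fin n} (hi : i.1 < k) (ω : Obs n Y) :
    ∑ e, flipLlr P l x i e (ω e)
      = ∑ e, maskedLlr P l x i (crossEdges k i) e (ω e)
        + ∑ e, maskedLlr P l x i (innerEdges k i) e (ω e) := by
  rw [← Finset.sum_add_distrib]
  refine Finset.sum_congr rfl fun e _ => ?_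
  simp only [maskedLlr, crossEdges, innerEdges, Finset.mem_filter, Finset.mem_univ, true_and]
  rcases H.cases hx i e with ⟨h1, h2, h'⟩ | ⟨h1, -⟩
  · rw [flipLlr, h', edgeLlr_self]
    simp
  · by_cases hk : e.1.1.1 < k
    · simp [hk, h1]
    · have h2 : e.1.2 = i := h1.resolve_left fun h => hk (h ▸ hi)
      simp [hk, h2]

lemma sum_ite_mem_le {ι : Type*} [Fintype ι] [DecidableEq ι] (S : Finset ι) (c : ℝ) :
    ∑ e, (if e ∈ S then c else 0) = S.card * c := by
  simp

open Classical in
/-- The log-likelihood ratio on the cross edges is small with a probability that is not too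
small. -/
lemma ClosePairs.cross_prob_ge (H : ClosePairs P l h η) (hx : ∀ i, x i = 0 ∨ x i = l)
    (i : Fin n) (hη0 : 0 ≤ η) (hη : η ≤ 1 / 2) (hh : h ≤ η) {τ b : ℝ} (hτ : (n : ℝ) * ((p : ℝ) * h) ≤ τ)
    (hb : 0 < b) (hbτ : 16 * τ + (16 * η * τ) ^ 2 ≤ b ^ 2 / 2) :
    Real.exp (-(τ / (1 - η)) - b / 2) / 2
      ≤ piExp (fun e : Pairs n => edgeWeight p (P (x e.1.1 - x e.1.2)))
        (fun ω => if |∑ e, maskedLlr P l x i (crossEdges k i) e (ω e)| ≤ b then 1 else 0) := by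
  have hh0 : 0 ≤ h := H.right.nonneg
  have hph0 : 0 ≤ p * h := mul_nonneg p.2.1 hh0
  have hcase : ∀ e : Pairs n, (∀ o, maskedLlr P l x i (crossEdges k i) e o = 0)
      ∨ (e ∈ crossEdges k i ∧
        maskedLlr P l x i (crossEdges k i) e
          = edgeLlr (P (x e.1.1 - x e.1.2)) (P (flipAt l x i e.1.1 - flipAt l x i e.1.2)) ∧
        IsClosePair (P (x e.1.1 - x e.1.2)) (P (flipAt l x i e.1.1 - flipAt l x i e.1.2)) h η) := by
    intro e
    by_cases he : e ∈ crossEdges k i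
    · rcases H.cases hx i e with ⟨h1, h2, h'⟩ | ⟨h1, h'⟩
      · exact absurd (Finset.mem_filter.1 he).2.2 h2
      · exact Or.inr ⟨he, funext fun o => by simp [maskedLlr, he, flipLlr], h'⟩
    · exact Or.inl fun o => by simp [maskedLlr, he]
  have ht0 : ∀ e : Pairs n, 0 ≤ if e ∈ crossEdges k i then (p : ℝ) * h else 0 := fun e => by
    split_ifs <;> simp [hph0]
  refine piExp_abs_sum_le_ge (t := fun e => if e ∈ crossEdges k i then (p : ℝ) * h else 0)
    (fun e o => edgeWeight_nonneg p _ o) hη0 hη ht0 ?_ ?_ ?_ ?_ ?_ hb hbτ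
  · intro e
    split_ifs
    · exact (mul_le_of_le_one_left hh0 p.2.2).trans hh
    · exact hη0
  · intro e
    rcases hcase e with h0 | ⟨he, h1, h2⟩
    · simp only [h0, zero_div, Real.exp_zero, mul_one, sum_edgeWeight]
      linarith [ht0 e]
    · simp only [he, if_true]
      rw [h1]
      exact h2.edge_sum_exp_half_ge p
  · intro e
    rcases hcase e with h0 | ⟨he, h1, h2⟩
    · simp only [h0, mul_zero, Finset.sum_const_zero, abs_zero]
      exact mul_nonneg (by positivity) (ht0 e)
    · simp only [he, if_true]
      rw [h1]
      exact h2.edge_abs_sum_exp_half_mul_le p hη0 (by linarith)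
  · intro e
    rcases hcase e with h0 | ⟨he, h1, h2⟩
    · simp only [h0, ne_eq, OfNat.ofNat_ne_zero, not_false_eq_true, zero_pow, mul_zero,
        Finset.sum_const_zero]
      exact mul_nonneg (by positivity) (ht0 e)
    · simp only [he, if_true]
      rw [h1]
      exact h2.edge_sum_exp_half_mul_sq_le p
  · rw [sum_ite_mem_le]
    have : ((crossEdges k i).card : ℝ) ≤ n := by exact_mod_cast card_crossEdges_le k i
    exact (mul_le_mul_of_nonneg_right this hph0).trans hτ

open Classical in
/-- The log-likelihood ratio on the inner edges is unlikely to be very negative. -/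
lemma ClosePairs.inner_prob_le (H : ClosePairs P l h η) (hx : ∀ i, x i = 0 ∨ x i = l)
    (hk : k ≤ n) (i : Fin n) (hη : η ≤ 1) (b : ℝ) :
    piExp (fun e : Pairs n => edgeWeight p (P (x e.1.1 - x e.1.2)))
        (fun ω => if -b ≤ ∑ e, maskedLlr P l x i (innerEdges k i) e (ω e) then 0 else 1)
      ≤ Real.exp (36 * (k * (p * h)) - b) := by
  have hph0 : 0 ≤ p * h := mul_nonneg p.2.1 H.right.nonneg
  refine piExp_sum_lt_neg_le
    (t := fun e => if e ∈ innerEdges k i then 18 * ((p : ℝ) * h) else 0)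
    (fun e o => edgeWeight_nonneg p _ o) ?_ ?_
  · intro e
    by_cases he : e ∈ innerEdges k i
    · rcases H.cases hx i e with ⟨h1, h2, h'⟩ | ⟨h1, h'⟩
      · exact absurd (Finset.mem_filter.1 he).2.2 (by tauto)
      · simp only [maskedLlr, he, if_true]
        exact h'.edge_sum_exp_neg_le p hη
    · simp only [maskedLlr, he, if_false, neg_zero, Real.exp_zero, mul_one, sum_edgeWeight,
        add_zero, le_refl]
  · rw [sum_ite_mem_le]
    have : ((innerEdges k i).card : ℝ) ≤ 2 * k := by exact_mod_cast card_innerEdges_le hk i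
    nlinarith [mul_le_mul_of_nonneg_right this hph0]

omit [Fintype Y] in
lemma dependsOn_sum_maskedLlr (P : ZMod m → PMF Y) (l : ZMod m) (x : Fin n → ZMod m) (i : Fin n)
    (S : Finset (Pairs n)) (F : ℝ → ℝ) :
    DependsOn (fun ω : Obs n Y => F (∑ e, maskedLlr P l x i S e (ω e))) (S : Set (Pairs n)) := by
  intro ω ω' hω
  dsimp only
  congr 1
  refine Finset.sum_congr rfl fun e _ => ?_
  by_cases he : e ∈ S
  · rw [hω e (Finset.mem_coe.2 he)]
  · simp [maskedLlr, he]

/-- A lower bound for the minimax error at a fixed number of variables. -/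
theorem ClosePairs.minimaxError_ge [NeZero m] (H : ClosePairs P l h η) (hl : l ≠ 0) (hk0 : 0 < k)
    (hk : k ≤ n) (hη0 : 0 ≤ η) (hη : η ≤ 1 / 2) (hh : h ≤ η) {τ b q : ℝ}
    (hτ : (n : ℝ) * ((p : ℝ) * h) ≤ τ) (hb : 0 < b) (hbτ : 16 * τ + (16 * η * τ) ^ 2 ≤ b ^ 2 / 2)
    (hq0 : 0 < q) (hq : q ≤ Real.exp (-(τ / (1 - η)) - b / 2) / 2) :
    ENNReal.ofReal (1 - (4 / (k * q) + 4 * Real.exp (36 * (k * (p * h)) - b)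
      + m / (k * q / 4 * Real.exp (-(2 * b))))) ≤ minimaxError n p P := by
  classical
  have hkq : 0 < k * q := mul_pos (by exact_mod_cast hk0) hq0
  refine le_iInf fun g => ?_
  set f : (Fin n → ZMod m) → Fin n → Obs n Y → ℝ := fun x i ω =>
    if |∑ e, maskedLlr P l x i (crossEdges k i) e (ω e)| ≤ b then 1 else 0 with hf
  set r : (Fin n → ZMod m) → Fin n → Obs n Y → ℝ := fun x i ω =>
    if -b ≤ ∑ e, maskedLlr P l x i (innerEdges k i) e (ω e) then 0 else 1 with hr
  have hval : ∀ x ∈ blockStates n k l, ∀ i, x i = 0 ∨ x i = l := fun x hx i =>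
    (mem_blockStates.1 hx i).imp_right And.right
  suffices hsuff : ∃ x ∈ blockStates n k l,
      1 - (4 / (k * q) + 4 * Real.exp (36 * (k * (p * h)) - b)
        + m / (k * q / 4 * Real.exp (-(2 * b)))) ≤ (errorProb p P g x).toReal by
    obtain ⟨x, -, hle⟩ := hsuff
    exact le_iSup_of_le x (ENNReal.ofReal_le_of_le_toReal hle)
  refine exists_errorProb_ge (lt_of_lt_of_le hk0 hk) p P g
    (blockStates_nonempty (n := n) (k := k) (l := l))
    (fun x ω => k * q / 4 ≤ ∑ i ∈ block n k, f x i ω * (1 - r x i ω))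
    (T := k * q / 4 * Real.exp (-(2 * b)))
    (β := 4 / (k * q) + 4 * Real.exp (36 * (k * (p * h)) - b)) (by positivity) ?_ ?_
  · intro x hx ω hG
    have hw : 0 ≤ (obsLaw p P x ω).toReal := ENNReal.toReal_nonneg
    calc _ ≤ (∑ i ∈ block n k, f x i ω * (1 - r x i ω)) * Real.exp (-(2 * b))
          * (obsLaw p P x ω).toReal :=
          mul_le_mul_of_nonneg_right (mul_le_mul_of_nonneg_right hG (Real.exp_pos _).le) hw
      _ = ∑ i ∈ block n k, f x i ω * (1 - r x i ω) * Real.exp (-(2 * b))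
          * (obsLaw p P x ω).toReal := by rw [Finset.sum_mul, Finset.sum_mul]
      -- A counted flip has log-likelihood ratio at least `-b - b`; the other flips enter with a
      -- nonnegative weight.
      _ ≤ ∑ i ∈ block n k, (obsLaw p P (flipAt l x i) ω).toReal := by
          refine Finset.sum_le_sum fun i hi => ?_
          rw [H.obsLaw_flipAt (hval x hx), mul_comm]
          refine mul_le_mul_of_nonneg_left ?_ hw
          rw [H.sum_flipLlr (hval x hx) (mem_block.1 hi)]
          simp only [hf, hr]
          split_ifs with h1 h2
          · rw [sub_zero, one_mul, one_mul]
            exact Real.exp_le_exp.2 (by linarith [(abs_le.1 h1).1])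
          · simp [Real.exp_nonneg]
          · simp [Real.exp_nonneg]
          · simp [Real.exp_nonneg]
      _ = ∑ x' ∈ (block n k).image (flipAt l x), (obsLaw p P x' ω).toReal :=
          (Finset.sum_image (f := fun x' => (obsLaw p P x' ω).toReal)
            (flipAt_injective hl (hval x hx)).injOn).symm
      _ ≤ _ := by
          refine Finset.sum_le_sum_of_subset_of_nonneg ?_ fun _ _ _ => ENNReal.toReal_nonneg
          intro x' hx'
          obtain ⟨i, hi, rfl⟩ := Finset.mem_image.1 hx'
          exact flipAt_mem hx (mem_block.1 hi)
  · intro x hx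
    have hx' := hval x hx
    have hw0 : ∀ (e : Pairs n) o, 0 ≤ edgeWeight p (P (x e.1.1 - x e.1.2)) o :=
      fun e o => edgeWeight_nonneg p _ o
    have hw1 : ∀ e : Pairs n, ∑ o, edgeWeight p (P (x e.1.1 - x e.1.2)) o = 1 :=
      fun e => sum_edgeWeight p _
    have hdep : ∀ i, DependsOn (f x i) (crossEdges k i : Set (Pairs n)) := fun i =>
      dependsOn_sum_maskedLlr P l x i (crossEdges k i) fun t => if |t| ≤ b then 1 else 0
    have hdep' : ∀ i, DependsOn (r x i) (innerEdges k i : Set (Pairs n)) := fun i =>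
      dependsOn_sum_maskedLlr P l x i (innerEdges k i) fun t => if -b ≤ t then 0 else 1
    set w : Pairs n → Option Y → ℝ := fun e => edgeWeight p (P (x e.1.1 - x e.1.2)) with hw
    have hfq : ∀ i, q ≤ piExp w (f x i) := fun i =>
      hq.trans (H.cross_prob_ge hx' i hη0 hη hh hτ hb hbτ)
    have hμ : k * q ≤ ∑ i ∈ block n k, piExp w (f x i) := by
      have := Finset.card_nsmul_le_sum (block n k) (fun i => piExp w (f x i)) q fun i _ => hfq i
      rwa [card_block hk, nsmul_eq_mul] at this
    have hμ0 := hkq.trans_le hμ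
    have hcount := piExp_count_lt_le hw0 hw1 (block n k) (f x) (r x)
      (fun i ω => by simp only [hf]; split_ifs <;> simp)
      (fun i ω => by simp only [hr]; split_ifs <;> simp)
      -- An edge has only one smaller end, so cross edges at distinct indices are disjoint; cross
      -- and inner edges differ in the position of the larger end.
      (fun i _ j _ hij => piExp_mul_of_dependsOn hw1 (crossEdges k i) (hdep i)
        ((hdep j).mono fun e he he' => hij
          ((Finset.mem_filter.1 he').2.2.symm.trans (Finset.mem_filter.1 he).2.2)))
      (fun i _ => piExp_mul_of_dependsOn hw1 (crossEdges k i) (hdep i)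
        ((hdep' i).mono fun e he he' => (Finset.mem_filter.1 he').2.1 (Finset.mem_filter.1 he).2.1))
      (ε := Real.exp (36 * (k * (p * h)) - b))
      (fun i _ => H.inner_prob_le hx' hk i (by linarith) b) rfl hμ0
    calc _ = piExp w (fun ω =>
          if k * q / 4 ≤ ∑ i ∈ block n k, f x i ω * (1 - r x i ω) then 0 else 1) := by
          simp only [piExp, obsLaw_toReal, hw]
      _ ≤ _ := piExp_mono hw0 fun ω => by
          split_ifs with h1 h2 h2
          · exact le_rfl
          · exact zero_le_one
          · exact absurd (le_trans (by linarith) h2) h1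
          · exact le_rfl
      _ ≤ _ := hcount
      _ ≤ _ := by
          have := div_le_div_of_nonneg_left (by norm_num : (0 : ℝ) ≤ 4) hkq hμ
          linarith

end LowerBound

/-! ### Choice of parameters and the limit. -/

section Asymptotics

variable {m n : ℕ} {Y : Type*} [Fintype Y] {P : ZMod m → PMF Y} {l : ZMod m} {h η : ℝ}

omit [Fintype Y] in
lemma shift_natCast {σ : Equiv.Perm Y} (hσ : ∀ l, P (l + 1) = (P l).map σ) (j : ZMod m) (t : ℕ) :
    P (j + t) = (P j).map (σ ^ t : Equiv.Perm Y) := by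
  induction t with
  | zero => simp [PMF.map_id]
  | succ t ih =>
    rw [Nat.cast_succ, ← add_assoc, hσ, ih, PMF.map_comp, pow_succ']
    rfl

/-- In the shift case the `l`-fold relabelling carries the laws at `-l, 0` to those at `0, l`; in
the reversible case `ρ` fixes `P 0` and carries `P l` to `P (-l)`. -/
lemma IsClosePair.closePairs [NeZero m] (hP : IsShiftFamily P ∨ IsReversible P)
    (H : IsClosePair (P 0) (P l) h η) : ClosePairs P l h η := by
  refine ⟨H, ?_⟩
  rcases hP with ⟨σ, hσ⟩ | ⟨ρ, hρ⟩
  · have h1 : P 0 = (P (-l)).map (σ ^ l.val : Equiv.Perm Y) := by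
      rw [← shift_natCast hσ, ZMod.natCast_zmod_val, neg_add_cancel]
    have h2 : P l = (P 0).map (σ ^ l.val : Equiv.Perm Y) := by
      rw [← shift_natCast hσ, ZMod.natCast_zmod_val, zero_add]
    rw [h2] at H
    nth_rewrite 1 [h1] at H
    exact H.of_map.symm
  · have h1 : P 0 = (P 0).map ρ := by simpa using hρ 0
    rw [h1, hρ l]
    exact H.map ρ

set_option maxHeartbeats 800000 in
/-- A polynomial lower bound for the minimax error when the divergence is below the threshold
`4 (1 - s) log n / (n p)`. -/
lemma minimaxError_ge_of_kl_lt [NeZero m] {p : unitInterval}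
    (hP : IsShiftFamily P ∨ IsReversible P) {κ s : ℝ} (hκ : 0 < κ)
    (hPκ : ∀ l y, κ ≤ (P l y).toReal) (hl : l ≠ 0) (hs0 : 0 < s) (hs1 : s < 1)
    (hn : 2 / (s / 576) ≤ n) (hL : 4096 / s ^ 2 ≤ Real.log n)
    (hp : 4 * (1 - s) * 4 / (κ * (s / 256) ^ 2) * Real.log n / n < p)
    (hK : kl (P 0) (P l) < 4 * (1 - s) * Real.log n / (n * p)) :
    ENNReal.ofReal (1 - (16 / (s / 576) + 4 + m * (16 / (s / 576)))
      * Real.exp (-(s / 16 * Real.log n))) ≤ minimaxError n p P := by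
  set L := Real.log n with hLdef
  set η := s / 256 with hη
  set a := s / 576 with ha
  set K := kl (P 0) (P l) with hKdef
  have ha0 : 0 < a := by positivity
  have hη0 : 0 < η := by positivity
  have hL0 : 0 < L := lt_of_lt_of_le (by positivity) hL
  have hn0 : (0 : ℝ) < n := lt_of_lt_of_le (by positivity) hn
  have hp0 : (0 : ℝ) < p := lt_of_le_of_lt
    (div_nonneg (mul_nonneg (div_nonneg (by linarith) (by positivity)) hL0.le) hn0.le) hp
  have hκ1 : κ ≤ 1 := by
    obtain ⟨y, -⟩ := (P 0).support_nonempty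
    refine (hPκ 0 y).trans ?_
    rw [← sum_toReal (P 0)]
    exact Finset.single_le_sum (f := fun y => (P 0 y).toReal)
      (fun _ _ => ENNReal.toReal_nonneg) (Finset.mem_univ y)
  have hnp : 0 < n * (p : ℝ) := by positivity
  have hKnp : K * (n * p) < 4 * (1 - s) * L := (lt_div_iff₀ hnp).1 hK
  have hK0 : 0 ≤ K := kl_nonneg (fun y => hκ.trans_le (hPκ 0 y)) fun y => hκ.trans_le (hPκ l y)
  -- The constant in `hp` is chosen so that the two bounds combine to exactly this.
  have hKsmall : K ≤ κ * (η ^ 2 / 4) := by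
    rw [div_lt_iff₀ hn0, div_mul_eq_mul_div, div_lt_iff₀ (by positivity)] at hp
    by_contra! hcon
    have h1 := mul_lt_mul_of_pos_right hcon hnp
    nlinarith
  have hclose := isClosePair_of_kl_le hκ (hPκ 0) (hPκ l) hη0 (by linarith) hKsmall
  rw [← hKdef] at hclose
  set h := (1 + η) / (1 - η) * K / 4 with hh
  have hη1 : 0 < 1 - η := by linarith
  have hratio : (1 + η) / (1 - η) ≤ 3 := by
    rw [div_le_iff₀ hη1]; linarith
  have hhη : h ≤ η := by
    have h1 : (1 + η) / (1 - η) * K ≤ 3 * K := mul_le_mul_of_nonneg_right hratio hK0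
    have h2 : κ * (η ^ 2 / 4) ≤ 1 * (η ^ 2 / 4) :=
      mul_le_mul_of_nonneg_right hκ1 (by positivity)
    rw [hh]
    nlinarith
  have hh0 : 0 ≤ h := hclose.nonneg
  set τ := (1 + η) / (1 - η) * (1 - s) * L with hτ
  have hτh : n * ((p : ℝ) * h) ≤ τ := by
    have h1 : n * ((p : ℝ) * h) = (1 + η) / (1 - η) * (K * (n * p) / 4) := by rw [hh]; ring
    rw [h1, hτ, mul_assoc]
    refine mul_le_mul_of_nonneg_left (by linarith) (by positivity)
  have hτ1 : τ / (1 - η) ≤ (1 - s / 2) * L := by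
    rw [hτ, div_le_iff₀ hη1, div_mul_eq_mul_div, div_mul_eq_mul_div, div_le_iff₀ hη1]
    have h1 : (1 + η) * (1 - s) ≤ (1 - s / 2) * (1 - η) * (1 - η) := by
      rw [hη]; nlinarith
    nlinarith [mul_le_mul_of_nonneg_right h1 hL0.le]
  have hτ0 : 0 ≤ τ := le_trans (by positivity) hτh
  have hτL : τ ≤ L := by
    have h1 : τ ≤ τ / (1 - η) := le_div_self hτ0 hη1 (by linarith)
    nlinarith
  set b := s / 8 * L with hb
  have hb0 : 0 < b := by positivity
  -- Each summand gets half of `b² / 2 = s² L² / 128`: the first by `L ≥ 4096 / s²`, the second by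
  -- `η = s / 256`.
  have hbτ : 16 * τ + (16 * η * τ) ^ 2 ≤ b ^ 2 / 2 := by
    have h1 : 16 * L ≤ s ^ 2 * L ^ 2 / 256 := by
      rw [div_le_iff₀ (by positivity)] at hL
      nlinarith
    have h2 : (16 * η * τ) ^ 2 ≤ (16 * η * L) ^ 2 :=
      pow_le_pow_left₀ (by positivity) (mul_le_mul_of_nonneg_left hτL (by positivity)) 2
    have h3 : (16 * η * L) ^ 2 = s ^ 2 * L ^ 2 / 256 := by rw [hη]; ring
    have h4 : b ^ 2 / 2 = s ^ 2 * L ^ 2 / 128 := by rw [hb]; ring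
    linarith
  set k := ⌊a * n⌋₊ with hk
  have hka : (k : ℝ) ≤ a * n := Nat.floor_le (by positivity)
  have hk2 : a * n / 2 ≤ k := by
    have h1 := Nat.lt_floor_add_one (a * n)
    have h2 : 2 ≤ a * n := by
      rw [div_le_iff₀ ha0] at hn
      linarith
    rw [← hk] at h1
    linarith
  have hk0 : 0 < k := by
    have : (0 : ℝ) < k := lt_of_lt_of_le (by positivity) hk2
    exact_mod_cast this
  have hkn : k ≤ n := by
    have : (k : ℝ) ≤ n := hka.trans (mul_le_of_le_one_left hn0.le (by rw [ha]; linarith))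
    exact_mod_cast this
  set q := Real.exp (-((1 - s / 2) * L) - b / 2) / 2 with hq
  have hq0 : 0 < q := by positivity
  have hmain := (hclose.closePairs hP).minimaxError_ge (p := p) hl hk0 hkn hη0.le (by linarith)
    hhη hτh hb0 hbτ hq0 (by
      rw [hq]
      have : Real.exp (-((1 - s / 2) * L) - b / 2) ≤ Real.exp (-(τ / (1 - η)) - b / 2) :=
        Real.exp_le_exp.2 (by linarith)
      linarith)
  refine (ENNReal.ofReal_le_ofReal ?_).trans hmain
  set D := Real.exp (-(s / 16 * L)) with hD
  have hD0 : 0 < D := Real.exp_pos _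
  -- Here `36 a = s / 16`, half of the rate `s / 8` of `b`.
  have hexp : Real.exp (36 * (k * (p * h)) - b) ≤ D := by
    refine Real.exp_le_exp.2 ?_
    have h1 : k * ((p : ℝ) * h) ≤ a * (n * (p * h)) := by
      have := mul_le_mul_of_nonneg_right hka (mul_nonneg hp0.le hh0)
      linarith
    have h2 : a * (n * ((p : ℝ) * h)) ≤ a * L :=
      mul_le_mul_of_nonneg_left (hτh.trans hτL) ha0.le
    rw [hb]
    rw [ha] at h1 h2
    linarith
  have hkqb : a / 4 / D ≤ k * q * Real.exp (-(2 * b)) := by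
    have h1 : a / 4 / D = a * n / 2 * q * Real.exp (-(2 * b))
        * Real.exp (-(s / 8 * L)) := by
      have hn1 : (n : ℝ) = Real.exp L := (Real.exp_log hn0).symm
      -- The exponents give `s/2 - s/16 - s/4 - s/8 = s/16` times `L`; the last factor is slack,
      -- included to match the rate of `D`.
      have h2 : Real.exp L * Real.exp (-((1 - s / 2) * L) - b / 2) * Real.exp (-(2 * b))
          * Real.exp (-(s / 8 * L)) = D⁻¹ := by
        rw [hD, ← Real.exp_neg, ← Real.exp_add, ← Real.exp_add, ← Real.exp_add, hb]
        congr 1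
        ring
      rw [div_eq_mul_inv, ← h2, hn1, hq]
      ring
    rw [h1]
    have h3 : Real.exp (-(s / 8 * L)) ≤ 1 := Real.exp_le_one_iff.2 (by
      have : 0 < s / 8 * L := by positivity
      linarith)
    have h4 : a * n / 2 * q * Real.exp (-(2 * b)) ≤ k * q * Real.exp (-(2 * b)) :=
      mul_le_mul_of_nonneg_right (mul_le_mul_of_nonneg_right hk2 hq0.le) (Real.exp_pos _).le
    exact (mul_le_of_le_one_right (by positivity) h3).trans h4
  have hkq : a / 4 / D ≤ k * q := by
    refine hkqb.trans (mul_le_of_le_one_right (by positivity) (Real.exp_le_one_iff.2 ?_))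
    linarith
  have t1 : 4 / (k * q) ≤ 16 / a * D := by
    have := div_le_div_of_nonneg_left (by norm_num : (0 : ℝ) ≤ 4) (by positivity) hkq
    refine this.trans (le_of_eq ?_)
    field_simp
    norm_num
  have t2 : m / (k * q / 4 * Real.exp (-(2 * b))) ≤ m * (16 / a) * D := by
    have := div_le_div_of_nonneg_left (Nat.cast_nonneg m : (0 : ℝ) ≤ m) (by positivity)
      (show a / 4 / D / 4 ≤ k * q / 4 * Real.exp (-(2 * b)) by linarith)
    refine this.trans (le_of_eq ?_)
    field_simp
    norm_num
  have t3 : (16 / a + 4 + m * (16 / a)) * D = 16 / a * D + 4 * D + m * (16 / a) * D := by ring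
  linarith

end Asymptotics

end JointAlignment

theorem theorem4 (m : ℕ) [NeZero m] {Y : Type*} [Fintype Y]
    (κ : ℝ) (hκ : 0 < κ) (c : ℝ) (hc0 : 0 < c) (hc4 : c < 4) :
    ∃ c₀ : ℝ, 0 < c₀ ∧
      ∀ (P : ℕ → ZMod m → PMF Y) (pobs : ℕ → unitInterval),
        (∀ n, JointAlignment.IsShiftFamily (P n) ∨ JointAlignment.IsReversible (P n)) →
        (∀ n l y, κ ≤ (P n l y).toReal) →
        (∃ l : ZMod m, l ≠ 0 ∧
          ∀ᶠ n in atTop, JointAlignment.kl (P n 0) (P n l) = JointAlignment.klMin (P n)) →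
        (∀ᶠ n : ℕ in atTop, c₀ * Real.log n / n < (pobs n : ℝ)) →
        (∀ᶠ n : ℕ in atTop,
          JointAlignment.klMin (P n) < c * Real.log n / (n * (pobs n : ℝ))) →
        Tendsto (fun n => JointAlignment.minimaxError n (pobs n) (P n)) atTop (𝓝 1) := by
  -- The relative gap `s` below the threshold `4` fixes all later constants.
  obtain ⟨s, rfl⟩ : ∃ s : ℝ, c = 4 * (1 - s) := ⟨1 - c / 4, by ring⟩
  have hs0 : 0 < s := by linarith
  have hs1 : s < 1 := by linarith
  refine ⟨4 * (1 - s) * 4 / (κ * (s / 256) ^ 2),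
    div_pos (mul_pos hc0 (by norm_num)) (by positivity), ?_⟩
  rintro P pobs hP hPκ ⟨l, hl, hlmin⟩ hp hK
  have hlog : Tendsto (fun n : ℕ => Real.log n) atTop atTop :=
    Real.tendsto_log_atTop.comp tendsto_natCast_atTop_atTop
  have hexp : Tendsto (fun n : ℕ => Real.exp (-(s / 16 * Real.log n))) atTop (𝓝 0) :=
    Real.tendsto_exp_neg_atTop_nhds_zero.comp (hlog.const_mul_atTop (by positivity))
  have hlower : Tendsto (fun n : ℕ =>
      ENNReal.ofReal (1 - (16 / (s / 576) + 4 + m * (16 / (s / 576)))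
        * Real.exp (-(s / 16 * Real.log n)))) atTop (𝓝 1) := by
    have h := ENNReal.tendsto_ofReal
      ((hexp.const_mul (16 / (s / 576) + 4 + m * (16 / (s / 576)))).const_sub 1)
    simpa using h
  refine tendsto_of_tendsto_of_tendsto_of_le_of_le' hlower tendsto_const_nhds ?_
    (Eventually.of_forall fun n => JointAlignment.minimaxError_le_one n _ _)
  filter_upwards [hlmin, hp, hK, hlog.eventually_ge_atTop (4096 / s ^ 2),
    tendsto_natCast_atTop_atTop.eventually_ge_atTop (2 / (s / 576))] with n h1 h2 h3 h4 h5
  exact JointAlignment.minimaxError_ge_of_kl_lt (hP n) hκ (hPκ n) hl hs0 hs1 h5 h4 h2 (h1 ▸ h3)
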